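/- Let $\mathcal A$ be a finite-dimensional commutative, associative, unital Frobenius algebra over $\mathbb R$ (there is a linear form $\omega$ on $\mathcal A$ with $\langle a,b\rangle=\omega(a\circ b)$ nondegenerate). Let $\mathbb R^\infty=\bigcup_n\mathbb R^n$ be the space of finitely supported times $t=(t_1,t_2,\dots)$, $x=t_1$, and let $D\subseteq\mathbb R^\infty$ be a nonempty star-shaped set whose preimage under every linear map $\mathbb R^n\to\mathbb R^\infty$ is open (for instance $D=\mathbb R^\infty$). Let $R$ be the ring of $\mathcal A$-valued functions on $D$ that are $C^\infty$ along every linear map $\mathbb R^n\to\mathbb R^\infty$ (on the preimage of $D$), with $\partial_k=\partial/\partial t_k$ and $\partial=\partial_1$. Let $L=\partial+U_1\partial^{-1}+U_2\partial^{-2}+\cdots$, $U_i\in R$, be a formal pseudo-differential operator that solves the $\mathcal A$-KP hierarchy $$\partial_{t_r}L=[L^r_+,L],\qquad r=1,2,\dots$$ A wave operator of $L$ is an operator $\Phi=1+W_1\partial^{-1}+W_2\partial^{-2}+\cdots$, $W_i\in R$, with $L=\Phi\circ\partial\circ\Phi^{-1}$ and $\partial_r\Phi=-L^r_-\circ\Phi$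 for all $r\ge1$; put $W_0=1$ and $\widehat W(t,z)=\sum_{i\ge0}W_i(t)z^{-i}\in R[[z^{-1}]]$. The Miwa shift $G(z)[f]=f(t_1-\tfrac1z,t_2-\tfrac1{2z^2},t_3-\tfrac1{3z^3},\dots)$ of $f\in R$ denotes its formal Taylor expansion $\exp\bigl(-\sum_{k\ge1}\tfrac{1}{kz^k}\partial_k\bigr)f\in R[[z^{-1}]]$. An invertible $\tau\in R$ is called a $\tau$-function of $L$ if $$\widehat W(t,z)=G(z)[\tau(t)]\circ\tau(t)^{-1}\qquad(*)$$ for some wave operator $\Phi$ of $L$. Then: 1. $L$ has a wave operator. 2. For every wave operator $\Phi$ of $L$ there is an invertible $\tau\in R$ satisfying $(*)$. For this fixed $\Phi$, an invertible $\tau'\in R$ satisfies $(*)$ if and only if $\tau'=C_0\circ\tau$ for some invertible constant $C_0\in\mathcal A$. 3. If $\tau$ is a $\tau$-function of $L$, then an invertible $\tau'\in R$ is a $\tau$-function of $L$ if and only if $$\tau'=C_0\circ e^{\sum_{k\ge1}C_kt_k}\circ\tau$$ for some invertible constant $C_0\in\mathcal A$ and some constants $C_1,C_2,\dots\in\mathcal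 A$. -/

import Mathlib

open scoped ContDiff

noncomputable section

/-! ## Frobenius algebras -/

/-- `tr` is a Frobenius (trace) form on the commutative unital `ℝ`-algebra `A`: the symmetric bilinear
form `⟨a, b⟩ = tr (a * b)` is nondegenerate. -/
def IsFrobeniusForm {A : Type*} [CommRing A] [Algebra ℝ A] (tr : Module.Dual ℝ A) : Prop :=
  ∀ a : A, (∀ b : A, tr (a * b) = 0) → a = 0

/-! ## Smooth functions of the infinitely many times `t₁ = x, t₂, t₃, …` -/

/-- The space of times `t = (t₁, t₂, …)`: sequences with finitely many nonzero entries, that is, the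
union of the spaces `ℝⁿ`. -/
abbrev Times : Type := ℕ+ →₀ ℝ

/-- The domain of the functions under consideration: a star-shaped set of times that is open in the
finite topology (it meets every finite-dimensional space in an open set). The whole space is
allowed. -/
structure TimeDomain where
  carrier : Set Times
  isOpen_preimage : ∀ (n : ℕ) (l : (Fin n → ℝ) →ₗ[ℝ] Times), IsOpen (l ⁻¹' carrier)
  exists_center : ∃ t₀ ∈ carrier, StarConvex ℝ t₀ carrier

namespace TimeDomain

/-- The domain consisting of all times. -/
def whole : TimeDomain where
  carrier := Set.univ
  isOpen_preimage := fun _ _ => isOpen_univ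
  exists_center := ⟨0, trivial, starConvex_univ 0⟩

variable (D : TimeDomain)

theorem isOpen_preimage_of_finiteDimensional {V : Type*} [NormedAddCommGroup V] [NormedSpace ℝ V]
    [FiniteDimensional ℝ V] (l : V →ₗ[ℝ] Times) : IsOpen (l ⁻¹' D.carrier) := by
  have e : V ≃L[ℝ] (Fin (Module.finrank ℝ V) → ℝ) :=
    ContinuousLinearEquiv.ofFinrankEq (by simp)
  have h := (D.isOpen_preimage _ (l ∘ₗ e.symm.toLinearEquiv.toLinearMap)).preimage e.continuous
  convert h using 1
  ext v
  simp

end TimeDomain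

section Smooth

variable {A : Type*} [NormedCommRing A] {D : TimeDomain}

open Classical in
/-- Extension of a function on the domain by zero (its values off the domain play no role). -/
def extendZero (f : D.carrier → A) (t : Times) : A :=
  if h : t ∈ D.carrier then f ⟨t, h⟩ else 0

theorem extendZero_apply (f : D.carrier → A) {t : Times} (h : t ∈ D.carrier) :
    extendZero f t = f ⟨t, h⟩ := dif_pos h

variable [NormedAlgebra ℝ A]

/-- Smoothness of a function of the times: the restriction to every finite-dimensional space of times
is `C^∞`. The norm of the finite-dimensional algebra `A` only serves to fix its (unique) topology. -/
def IsSmooth (f : D.carrier → A) : Prop :=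
  ∀ (n : ℕ) (l : (Fin n → ℝ) →ₗ[ℝ] Times),
    ContDiffOn ℝ ∞ (fun v => extendZero f (l v)) (l ⁻¹' D.carrier)

theorem IsSmooth.contDiffOn {f : D.carrier → A} (hf : IsSmooth f) {V : Type*}
    [NormedAddCommGroup V] [NormedSpace ℝ V] [FiniteDimensional ℝ V] (l : V →ₗ[ℝ] Times) :
    ContDiffOn ℝ ∞ (fun v => extendZero f (l v)) (l ⁻¹' D.carrier) := by
  have e : V ≃L[ℝ] (Fin (Module.finrank ℝ V) → ℝ) :=
    ContinuousLinearEquiv.ofFinrankEq (by simp)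
  have h := (hf _ (l ∘ₗ e.symm.toLinearEquiv.toLinearMap)).comp
    (s := l ⁻¹' D.carrier) e.contDiff.contDiffOn (fun v hv => by simpa using hv)
  refine h.congr fun v _ => ?_
  simp

/-- The partial derivative `∂f/∂t_k`. -/
def partialDeriv (k : ℕ+) (f : D.carrier → A) (t : D.carrier) : A :=
  deriv (fun s : ℝ => extendZero f (t.1 + Finsupp.single k s)) 0

/-- The linear map `(v, s) ↦ l v + s e_k`. -/
def lineMap {V : Type*} [AddCommGroup V] [Module ℝ V] (l : V →ₗ[ℝ] Times) (k : ℕ+) :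
    V × ℝ →ₗ[ℝ] Times :=
  l.coprod (Finsupp.lsingle k)

theorem IsSmooth.hasDerivAt {f : D.carrier → A} (hf : IsSmooth f) (k : ℕ+) (t : D.carrier) :
    HasDerivAt (fun s : ℝ => extendZero f (t.1 + Finsupp.single k s)) (partialDeriv k f t) 0 := by
  let m := lineMap (LinearMap.toSpanSingleton ℝ Times t.1) k
  have hm : ∀ s : ℝ, m (1, s) = t.1 + Finsupp.single k s := fun s => by simp [m, lineMap]
  have hmem : ((1 : ℝ), (0 : ℝ)) ∈ m ⁻¹' D.carrier := by
    simp only [Set.mem_preimage, hm]; simp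
  have h := ((hf.contDiffOn m).contDiffAt
    ((D.isOpen_preimage_of_finiteDimensional m).mem_nhds hmem)).differentiableAt (by simp)
  have h2 : DifferentiableAt ℝ (fun s : ℝ => extendZero f (m (1, s))) 0 :=
    DifferentiableAt.comp (g := fun p : ℝ × ℝ => extendZero f (m p)) (0 : ℝ) h
      (by fun_prop : DifferentiableAt ℝ (fun s : ℝ => ((1 : ℝ), s)) 0)
  simp only [hm] at h2
  exact h2.hasDerivAt

theorem IsSmooth.partialDeriv {f : D.carrier → A} (hf : IsSmooth f) (k : ℕ+) :
    IsSmooth (partialDeriv k f) := by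
  intro n l
  let m := lineMap l k
  have hm : ∀ v s, m (v, s) = l v + Finsupp.single k s := fun v s => by simp [m, lineMap]
  have ho := D.isOpen_preimage_of_finiteDimensional m
  have hg := hf.contDiffOn m
  have hd := hg.fderiv_of_isOpen (m := ∞) ho (by simp)
  have hi : ContDiffOn ℝ ∞ (fun v : Fin n → ℝ => (v, (0 : ℝ))) (l ⁻¹' D.carrier) := by fun_prop
  have hc := (hd.comp hi (fun v hv => by simpa [hm] using hv)).clm_apply
    (contDiffOn_const (c := ((0 : Fin n → ℝ), (1 : ℝ))))
  refine hc.congr fun v hv => ?_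
  rw [extendZero_apply _ hv]
  have hmem : (v, (0 : ℝ)) ∈ m ⁻¹' D.carrier := by simpa [hm] using hv
  have h1 := ((hg.contDiffAt (ho.mem_nhds hmem)).differentiableAt (by simp)).hasFDerivAt
  have h2 : HasDerivAt (fun s : ℝ => (v, s)) ((0 : Fin n → ℝ), (1 : ℝ)) 0 :=
    (hasDerivAt_const (0 : ℝ) v).prodMk (hasDerivAt_id (0 : ℝ))
  have h3 := HasFDerivAt.comp_hasDerivAt (0 : ℝ) h1 h2
  simp only [Function.comp_def, hm] at h3
  exact h3.deriv

variable (A D) in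
/-- The algebra of smooth `A`-valued functions on `D`, with pointwise operations. -/
def SmoothFn : Subalgebra ℝ (D.carrier → A) where
  carrier := {f | IsSmooth f}
  mul_mem' := by
    intro f g hf hg n l
    refine ((hf n l).mul (hg n l)).congr fun v hv => ?_
    simp [extendZero_apply _ (Set.mem_preimage.1 hv)]
  add_mem' := by
    intro f g hf hg n l
    refine ((hf n l).add (hg n l)).congr fun v hv => ?_
    simp [extendZero_apply _ (Set.mem_preimage.1 hv)]
  algebraMap_mem' := by
    intro r n l
    refine (contDiffOn_const (c := algebraMap ℝ A r)).congr fun v hv => ?_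
    simp [extendZero_apply _ (Set.mem_preimage.1 hv)]

theorem eventually_mem (k : ℕ+) (t : D.carrier) :
    ∀ᶠ s : ℝ in nhds 0, t.1 + Finsupp.single k s ∈ D.carrier := by
  let m := lineMap (LinearMap.toSpanSingleton ℝ Times t.1) k
  have hm : ∀ s : ℝ, m (1, s) = t.1 + Finsupp.single k s := fun s => by simp [m, lineMap]
  have ho := (D.isOpen_preimage_of_finiteDimensional m).preimage
    (by fun_prop : Continuous (fun s : ℝ => ((1 : ℝ), s)))
  filter_upwards [ho.mem_nhds (x := 0) (by simp [hm])] with s hs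
  simpa [hm] using hs

variable (A D) in
/-- The derivation `∂_k = ∂/∂t_k` of the algebra of smooth functions. -/
def timeDeriv (k : ℕ+) : Derivation ℝ (SmoothFn A D) (SmoothFn A D) :=
  Derivation.mk'
    { toFun := fun f => ⟨partialDeriv k f.1, IsSmooth.partialDeriv f.2 k⟩
      map_add' := by
        intro f g
        ext t
        refine (((IsSmooth.hasDerivAt f.2 k t).add
          (IsSmooth.hasDerivAt g.2 k t)).congr_of_eventuallyEq ?_).deriv
        filter_upwards [eventually_mem k t] with s hs
        simp [extendZero_apply _ hs]
      map_smul' := by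
        intro r f
        ext t
        refine (((IsSmooth.hasDerivAt f.2 k t).const_smul r).congr_of_eventuallyEq ?_).deriv
        filter_upwards [eventually_mem k t] with s hs
        simp [extendZero_apply _ hs] }
    (by
      intro f g
      ext t
      have h := (((IsSmooth.hasDerivAt f.2 k t).mul
          (IsSmooth.hasDerivAt g.2 k t)).congr_of_eventuallyEq
            (f₁ := fun s : ℝ => extendZero (f.1 * g.1) (t.1 + Finsupp.single k s)) (by
        filter_upwards [eventually_mem k t] with s hs
        simp [extendZero_apply _ hs])).deriv
      change _root_.deriv _ 0 = f.1 t * partialDeriv k g.1 t + g.1 t * partialDeriv k f.1 t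
      refine h.trans ?_
      simp only [Finsupp.single_zero, add_zero, extendZero_apply _ t.2]
      ring)

/-- The space variable is `x = t₁`, so `∂ = ∂/∂x = ∂/∂t₁`. -/
instance : Differential (SmoothFn A D) where
  deriv := (timeDeriv A D 1).restrictScalars ℤ

end Smooth

/-! ## Pseudo-differential operators -/

/-- Formal pseudo-differential operators `∑_{i ≤ N} a_i ∂^i` over a commutative differential ring. -/
@[ext]
structure PsiDO (R : Type*) [CommRing R] where
  coeff : ℤ → R
  bounded : ∃ N : ℤ, ∀ i, N < i → coeff i = 0

namespace PsiDO

variable {R : Type*} [CommRing R]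

/-- The operator `∂^i`. -/
def dPow (i : ℤ) : PsiDO R where
  coeff := Pi.single i 1
  bounded := ⟨i, fun _ hj => Pi.single_eq_of_ne (ne_of_gt hj) 1⟩

instance : One (PsiDO R) := ⟨dPow 0⟩

instance : Neg (PsiDO R) :=
  ⟨fun P => ⟨fun i => -P.coeff i, by
    obtain ⟨N, hN⟩ := P.bounded
    exact ⟨N, fun i hi => by simp [hN i hi]⟩⟩⟩

instance : Sub (PsiDO R) :=
  ⟨fun P Q => ⟨fun i => P.coeff i - Q.coeff i, by
    obtain ⟨N, hN⟩ := P.bounded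
    obtain ⟨M, hM⟩ := Q.bounded
    exact ⟨max N M, fun i hi => by
      simp [hN i (lt_of_le_of_lt (le_max_left _ _) hi),
        hM i (lt_of_le_of_lt (le_max_right _ _) hi)]⟩⟩⟩

/-- Composition of operators, determined by the generalised Leibniz rule
`∂^i ∘ b = ∑_{k ≥ 0} (i choose k) b^{(k)} ∂^{i - k}` for all integers `i`. The coefficient of `∂^n`
in `(∑ a_i ∂^i) ∘ (∑ b_j ∂^j)` is the sum of the `(i choose k) a_i b_j^{(k)}` over `i + j - k = n`;
only finitely many of these terms are nonzero. -/
instance [Differential R] : Mul (PsiDO R) :=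
  ⟨fun P Q =>
    { coeff := fun n => ∑ᶠ p : ℤ × ℕ,
        Ring.choose p.1 p.2 •
          (P.coeff p.1 * (Differential.deriv : Derivation ℤ R R)^[p.2] (Q.coeff (n - p.1 + p.2)))
      bounded := by
        obtain ⟨N, hN⟩ := P.bounded
        obtain ⟨M, hM⟩ := Q.bounded
        refine ⟨N + M, fun n hn => finsum_eq_zero_of_forall_eq_zero fun p => ?_⟩
        rcases lt_or_ge N p.1 with h | h
        · simp [hN _ h]
        · rw [hM _ (by omega), iterate_map_zero]
          simp }⟩

instance [Differential R] : Pow (PsiDO R) ℕ :=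
  ⟨fun P r => Nat.rec 1 (fun _ Q => Q * P) r⟩

/-- The differential part `P₊ = ∑_{i ≥ 0} a_i ∂^i`. -/
def pos (P : PsiDO R) : PsiDO R where
  coeff := fun i => if 0 ≤ i then P.coeff i else 0
  bounded := by
    obtain ⟨N, hN⟩ := P.bounded
    exact ⟨N, fun i hi => by simp [hN i hi]⟩

/-- The integral part `P₋ = ∑_{i < 0} a_i ∂^i`. -/
def neg (P : PsiDO R) : PsiDO R := P - P.pos

/-- A derivation of the coefficient ring, applied to every coefficient. -/
def mapCoeff [Algebra ℝ R] (δ : Derivation ℝ R R) (P : PsiDO R) : PsiDO R where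
  coeff := fun i => δ (P.coeff i)
  bounded := by
    obtain ⟨N, hN⟩ := P.bounded
    exact ⟨N, fun i hi => by simp [hN i hi]⟩

end PsiDO

/-! ## The hierarchy, wave operators and τ-functions -/

section KP

variable {A : Type*} [NormedCommRing A] [NormedAlgebra ℝ A] {D : TimeDomain}

/-- `L` has the form `∂ + U₁ ∂⁻¹ + U₂ ∂⁻² + ⋯`. -/
def IsLaxOperator (L : PsiDO (SmoothFn A D)) : Prop :=
  (∀ i, 1 < i → L.coeff i = 0) ∧ L.coeff 1 = 1 ∧ L.coeff 0 = 0

/-- The KP hierarchy `∂L/∂t_r = [B_r, L]`, `B_r = (L^r)₊`, for `r = 1, 2, …`. -/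
def SolvesKP (L : PsiDO (SmoothFn A D)) : Prop :=
  ∀ r : ℕ+, L.mapCoeff (timeDeriv A D r) = (L ^ (r : ℕ)).pos * L - L * (L ^ (r : ℕ)).pos

/-- `Φ` is a dressing (wave) operator of `L`: it has the form `1 + W₁ ∂⁻¹ + W₂ ∂⁻² + ⋯`, it dresses
`∂` to `L = Φ ∘ ∂ ∘ Φ⁻¹`, and it evolves by `∂_r Φ = -(L^r)₋ ∘ Φ` for `r = 1, 2, …`. -/
structure IsWaveOperator (L Φ : PsiDO (SmoothFn A D)) : Prop where
  coeff_pos : ∀ i, 0 < i → Φ.coeff i = 0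
  coeff_zero : Φ.coeff 0 = 1
  dressing : ∃ Ψ : PsiDO (SmoothFn A D), Φ * Ψ = 1 ∧ Ψ * Φ = 1 ∧ L = Φ * PsiDO.dPow 1 * Ψ
  evolution : ∀ r : ℕ+, Φ.mapCoeff (timeDeriv A D r) = -((L ^ (r : ℕ)).neg * Φ)

/-- `Ŵ(t, z) = ∑_{i ≥ 0} W_i(t) z^{-i}` for `Φ = ∑_{i ≥ 0} W_i ∂^{-i}`, as a formal power series in
`X = z⁻¹`. -/
def waveSeries (Φ : PsiDO (SmoothFn A D)) : PowerSeries (SmoothFn A D) :=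
  PowerSeries.mk fun i => Φ.coeff (-(i : ℤ))

variable (A D) in
/-- The generator `-∑_{k ≥ 1} (z^{-k} / k) ∂_k` of the Miwa shift, a formal power series in `X = z⁻¹`
whose coefficients are operators on smooth functions. -/
def miwaGenerator : PowerSeries (Module.End ℝ (SmoothFn A D)) :=
  PowerSeries.mk fun k =>
    if h : 0 < k then -((k : ℝ)⁻¹ • (timeDeriv A D ⟨k, h⟩).toLinearMap) else 0

/-- The Miwa shift `G(z)[f] = f(t₁ - 1/z, t₂ - 1/(2z²), t₃ - 1/(3z³), …)`, understood as its formal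
Taylor expansion `exp(-∑_{k ≥ 1} (z^{-k} / k) ∂_k) f` in powers of `X = z⁻¹`. Since the generator has
no constant term, only its powers up to the `n`-th contribute to the coefficient of `X^n`. -/
def miwaShift (f : SmoothFn A D) : PowerSeries (SmoothFn A D) :=
  PowerSeries.mk fun n =>
    (∑ j ∈ Finset.range (n + 1),
      ((j.factorial : ℝ)⁻¹ • PowerSeries.coeff n (miwaGenerator A D ^ j))) f

/-- `Ŵ(t, z) = G(z)[τ] ∘ τ⁻¹` for the wave operator `Φ`, with `τ` an invertible smooth function. -/
def IsTauOfWave (Φ : PsiDO (SmoothFn A D)) (τ : (SmoothFn A D)ˣ) : Prop :=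
  waveSeries Φ = miwaShift (τ : SmoothFn A D) * PowerSeries.C ((τ⁻¹ : (SmoothFn A D)ˣ) : SmoothFn A D)

/-- `τ` is a τ-function of `L`: `Ŵ(t, z) = G(z)[τ] ∘ τ⁻¹` for some wave operator of `L`. -/
def IsTauFunction (L : PsiDO (SmoothFn A D)) (τ : (SmoothFn A D)ˣ) : Prop :=
  ∃ Φ, IsWaveOperator L Φ ∧ IsTauOfWave Φ τ

end KP

end

/-! Write X = 1/z and let V = X d/dX + ∑ X^k ∂_k, a derivation of R⟦X⟧. The Miwa shift G f is the
only series with constant term f that V annihilates (`isShift_miwaShift`, `IsShift.ext_of_flow`).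
Hence G is a ring homomorphism commuting with all ∂_k, and two series agree once they solve the same
linear equation for V with the same constant term.

Wave operators. The system ∂_r Φ = -(L^r)₋ Φ is triangular because (L^r)₋ has order at most -1: each
coefficient has its derivatives prescribed by the earlier ones. The zero curvature equations make
them compatible, and the Poincaré lemma integrates them (`exists_evolution`). The equation for r = 1
already says LΦ = Φ∂.

Existence of τ. Formally Φ exp(∑ t_k ∂^k) evolves by the differential operators (L^r)₊, and the Miwa
shift multiplies the exponential by 1 - X∂. So every coefficient of (GΦ)(1 - X∂) is EΦ with E
differential; from X² on it has order at most 0, so E is multiplication by a function. The resulting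
Fay relations (`PsiDO.satisfiesFay`) give the symmetry Ŵ(X) G(X)Ŵ(Y) = Ŵ(Y) G(Y)Ŵ(X). Let VŴ = -bŴ.
Applying V in Y to the symmetry gives ∂_k Ŵ = Ŵ (G b_k - b_k), and applying V in X to this gives ∂_j
b_k = ∂_k b_j. So b_k = ∂_k log τ for some τ, and both sides of (*) solve VF = -bF with constant
term 1.

Uniqueness. The map τ ↦ G(τ) τ⁻¹ is multiplicative, so everything depends on σ = τ'/τ. For a fixed Φ
the series of σ must be 1, that is, σ is constant. Two wave operators differ by a right factor with
constant coefficients, which multiplies Ŵ by a constant series; the series of σ is constant exactly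
when the ∂_k log σ are constants. -/

noncomputable section

/-! ### The ring of formal pseudo-differential operators. -/

namespace PsiDO

section Additive

variable {R : Type*} [CommRing R]

instance : Zero (PsiDO R) := ⟨⟨fun _ => 0, 0, fun _ _ => rfl⟩⟩

instance : Add (PsiDO R) :=
  ⟨fun P Q => ⟨fun i => P.coeff i + Q.coeff i, by
    obtain ⟨N, hN⟩ := P.bounded
    obtain ⟨M, hM⟩ := Q.bounded
    exact ⟨max N M, fun i hi => by
      simp [hN i (lt_of_le_of_lt (le_max_left _ _) hi),
        hM i (lt_of_le_of_lt (le_max_right _ _) hi)]⟩⟩⟩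

@[simp] theorem coeff_zero (i : ℤ) : (0 : PsiDO R).coeff i = 0 := rfl

@[simp] theorem coeff_add (P Q : PsiDO R) (i : ℤ) :
    (P + Q).coeff i = P.coeff i + Q.coeff i := rfl

@[simp] theorem coeff_sub (P Q : PsiDO R) (i : ℤ) :
    (P - Q).coeff i = P.coeff i - Q.coeff i := rfl

@[simp] theorem coeff_neg (P : PsiDO R) (i : ℤ) : (-P).coeff i = -P.coeff i := rfl

theorem coeff_one (i : ℤ) : (1 : PsiDO R).coeff i = if i = 0 then 1 else 0 := by
  change Pi.single (M := fun _ => R) 0 1 i = _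
  rw [Pi.single_apply]

theorem coeff_dPow (j i : ℤ) : (dPow j : PsiDO R).coeff i = if i = j then 1 else 0 := by
  change Pi.single (M := fun _ => R) j 1 i = _
  rw [Pi.single_apply]

instance : AddCommGroup (PsiDO R) where
  add_assoc _ _ _ := PsiDO.ext (funext fun _ => add_assoc _ _ _)
  zero_add _ := PsiDO.ext (funext fun _ => zero_add _)
  add_zero _ := PsiDO.ext (funext fun _ => add_zero _)
  neg_add_cancel _ := PsiDO.ext (funext fun _ => neg_add_cancel _)
  add_comm _ _ := PsiDO.ext (funext fun _ => add_comm _ _)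
  sub_eq_add_neg _ _ := PsiDO.ext (funext fun _ => sub_eq_add_neg _ _)
  nsmul := nsmulRec
  zsmul := zsmulRec

/-- The coefficients of an operator as an additive map. -/
def coeffHom (i : ℤ) : PsiDO R →+ R where
  toFun P := P.coeff i
  map_zero' := rfl
  map_add' _ _ := rfl

theorem coeff_sum {ι : Type*} (s : Finset ι) (f : ι → PsiDO R) (i : ℤ) :
    (∑ j ∈ s, f j).coeff i = ∑ j ∈ s, (f j).coeff i :=
  map_sum (coeffHom i) f s

theorem coeff_nsmul (n : ℕ) (P : PsiDO R) (i : ℤ) : (n • P).coeff i = n • P.coeff i :=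
  map_nsmul (coeffHom i) n P

/-- `P` has order at most `n`. -/
def OrderLE (n : ℤ) (P : PsiDO R) : Prop := ∀ i, n < i → P.coeff i = 0

/-- `P` is a differential operator. -/
def IsDifferential (P : PsiDO R) : Prop := ∀ i, i < 0 → P.coeff i = 0

theorem OrderLE.mono {m n : ℤ} {P : PsiDO R} (h : OrderLE m P) (hmn : m ≤ n) : OrderLE n P :=
  fun i hi => h i (by omega)

theorem OrderLE.sub {n : ℤ} {P Q : PsiDO R} (hP : OrderLE n P) (hQ : OrderLE n Q) :
    OrderLE n (P - Q) := fun i hi => by simp [hP i hi, hQ i hi]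

theorem OrderLE.neg {n : ℤ} {P : PsiDO R} (hP : OrderLE n P) : OrderLE n (-P) :=
  fun i hi => by simp [hP i hi]

theorem orderLE_dPow (i : ℤ) : OrderLE i (dPow i : PsiDO R) := fun j hj => by
  rw [coeff_dPow, if_neg (by omega)]

theorem exists_orderLE (P : PsiDO R) : ∃ n, OrderLE n P := P.bounded

theorem coeff_pos_part (P : PsiDO R) (i : ℤ) : P.pos.coeff i = if 0 ≤ i then P.coeff i else 0 := rfl

theorem isDifferential_pos (P : PsiDO R) : IsDifferential P.pos := fun i hi => by
  rw [coeff_pos_part, if_neg (by omega)]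

theorem orderLE_neg_part (P : PsiDO R) : OrderLE (-1) P.neg := fun i hi => by
  change P.coeff i - P.pos.coeff i = 0
  rw [coeff_pos_part, if_pos (by omega), sub_self]

theorem pos_add_neg_part (P : PsiDO R) : P.pos + P.neg = P := by
  change P.pos + (P - P.pos) = P
  abel

/-- The monomial `a ∂^i`. -/
def mono (a : R) (i : ℤ) : PsiDO R where
  coeff j := if j = i then a else 0
  bounded := ⟨i, fun _ hj => if_neg (ne_of_gt hj)⟩

theorem coeff_mono (a : R) (j i : ℤ) : (mono a j).coeff i = if i = j then a else 0 := rfl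

theorem mono_one (i : ℤ) : mono (1 : R) i = dPow i :=
  PsiDO.ext (funext fun j => by rw [coeff_mono, coeff_dPow])

/-- Up to operators of low order, every operator is a finite sum of monomials. -/
theorem exists_eq_sum_mono_add (P : PsiDO R) (n : ℤ) :
    ∃ (s : Finset ℤ) (Q : PsiDO R), OrderLE n Q ∧ P = (∑ i ∈ s, mono (P.coeff i) i) + Q := by
  obtain ⟨N, hN⟩ := P.bounded
  refine ⟨Finset.Ioc n N, P - ∑ i ∈ Finset.Ioc n N, mono (P.coeff i) i, fun i hi => ?_, by abel⟩
  simp only [coeff_sub, coeff_sum, coeff_mono, Finset.sum_ite_eq, Finset.mem_Ioc]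
  split_ifs with h
  · simp
  · rw [hN i (by omega), sub_zero]

theorem pascal_finsum (i : ℤ) (f : ℕ → R) (hf : f.support.Finite) :
    ∑ᶠ k : ℕ, Ring.choose (i + 1) k • f k =
      (∑ᶠ k : ℕ, Ring.choose i k • f k) + ∑ᶠ k : ℕ, Ring.choose i k • f (k + 1) := by
  obtain ⟨B, hB⟩ : ∃ B, ∀ k, B ≤ k → f k = 0 := by
    obtain ⟨B, hB⟩ := hf.bddAbove
    refine ⟨B + 1, fun k hk => ?_⟩
    by_contra hc
    have := hB (show k ∈ f.support from hc)
    omega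
  have key : ∀ (c : ℕ → ℤ) (g : ℕ → R) (n : ℕ), (∀ k, n ≤ k → g k = 0) →
      ∑ᶠ k : ℕ, c k • g k = ∑ k ∈ Finset.range n, c k • g k := fun c g n hg => by
    refine finsum_eq_sum_of_support_subset _ fun k hk => ?_
    by_contra hc
    apply hk
    simp only [Finset.coe_range, Set.mem_Iio, not_lt] at hc
    simp [hg k hc]
  rw [key _ _ (B + 1) (fun k hk => hB k (by omega)), key _ _ (B + 1) (fun k hk => hB k (by omega)),
    key _ (fun k => f (k + 1)) B (fun k hk => hB _ (by omega)), Finset.sum_range_succ',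
    Finset.sum_range_succ' _ B]
  simp only [Ring.choose_succ_succ, add_smul, Finset.sum_add_distrib, Ring.choose_zero_right]
  abel

theorem isDifferential_one : IsDifferential (1 : PsiDO R) := fun i hi => by
  rw [coeff_one, if_neg (by omega)]

end Additive

section Ring

variable {R : Type*} [CommRing R] [Differential R]

/-- The derivation of the coefficient ring. -/
local notation "∂" => (Differential.deriv : Derivation ℤ R R)

theorem coeff_mul (P Q : PsiDO R) (n : ℤ) : (P * Q).coeff n = ∑ᶠ p : ℤ × ℕ,
    Ring.choose p.1 p.2 • (P.coeff p.1 * (∂)^[p.2] (Q.coeff (n - p.1 + p.2))) := rfl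

theorem finite_support_coeff_mul (P Q : PsiDO R) (n : ℤ) :
    (Function.support fun p : ℤ × ℕ =>
      Ring.choose p.1 p.2 • (P.coeff p.1 * (∂)^[p.2] (Q.coeff (n - p.1 + p.2)))).Finite := by
  obtain ⟨N, hN⟩ := P.bounded
  obtain ⟨M, hM⟩ := Q.bounded
  refine ((Finset.Icc (n - M) N) ×ˢ (Finset.range (M - n + N + 1).toNat)).finite_toSet.subset ?_
  intro p hp
  by_contra hc
  apply hp
  dsimp only
  by_cases h1 : N < p.1
  · simp [hN _ h1]
  · rw [hM, iterate_map_zero]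
    · simp
    · simp only [Finset.coe_product, Set.mem_prod, Finset.coe_Icc, Set.mem_Icc, Finset.coe_range,
        Set.mem_Iio] at hc
      omega

theorem add_mul' (P Q S : PsiDO R) : (P + Q) * S = P * S + Q * S := by
  ext n
  rw [coeff_add, coeff_mul, coeff_mul, coeff_mul,
    ← finsum_add_distrib (finite_support_coeff_mul P S n) (finite_support_coeff_mul Q S n)]
  exact finsum_congr fun p => by rw [coeff_add, add_mul, smul_add]

theorem mul_add' (P Q S : PsiDO R) : P * (Q + S) = P * Q + P * S := by
  ext n
  rw [coeff_add, coeff_mul, coeff_mul, coeff_mul,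
    ← finsum_add_distrib (finite_support_coeff_mul P Q n) (finite_support_coeff_mul P S n)]
  exact finsum_congr fun p => by rw [coeff_add, iterate_map_add, mul_add, smul_add]

instance : NonUnitalNonAssocRing (PsiDO R) where
  left_distrib := mul_add'
  right_distrib := add_mul'
  zero_mul Q := by
    ext n
    rw [coeff_mul]
    exact finsum_eq_zero_of_forall_eq_zero fun p => by simp
  mul_zero Q := by
    ext n
    rw [coeff_mul]
    exact finsum_eq_zero_of_forall_eq_zero fun p => by simp [iterate_map_zero]

theorem OrderLE.mul {m n : ℤ} {P Q : PsiDO R} (hP : OrderLE m P) (hQ : OrderLE n Q) :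
    OrderLE (m + n) (P * Q) := fun i hi => by
  rw [coeff_mul]
  refine finsum_eq_zero_of_forall_eq_zero fun p => ?_
  rcases lt_or_ge m p.1 with h | h
  · simp [hP _ h]
  · rw [hQ _ (by omega), iterate_map_zero]
    simp

/-- The coefficients of `a ∂^i ∘ Q`. -/
theorem coeff_mono_mul (a : R) (i : ℤ) (Q : PsiDO R) (n : ℤ) :
    (mono a i * Q).coeff n =
      a * ∑ᶠ k : ℕ, Ring.choose i k • (∂)^[k] (Q.coeff (n - i + k)) := by
  have hs : (Function.support fun k : ℕ =>
      Ring.choose i k • (∂)^[k] (Q.coeff (n - i + k))).Finite := by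
    obtain ⟨M, hM⟩ := Q.bounded
    refine (Finset.range (M - n + i + 1).toNat).finite_toSet.subset fun k hk => ?_
    by_contra hc
    apply hk
    simp only [Finset.coe_range, Set.mem_Iio] at hc
    dsimp only
    rw [hM _ (by omega), iterate_map_zero, smul_zero]
  rw [← smul_eq_mul (a := a), smul_finsum' _ hs, coeff_mul, finsum_curry _ (finite_support_coeff_mul _ _ _),
    finsum_eq_single _ i]
  · refine finsum_congr fun k => ?_
    rw [coeff_mono, if_pos rfl, smul_eq_mul, mul_smul_comm]
  · intro j hj
    refine finsum_eq_zero_of_forall_eq_zero fun k => ?_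
    simp [coeff_mono, hj]

theorem coeff_mono_zero_mul (a : R) (Q : PsiDO R) (n : ℤ) :
    (mono a 0 * Q).coeff n = a * Q.coeff n := by
  rw [coeff_mono_mul, finsum_eq_single _ 0]
  · simp
  · intro k hk
    rw [Ring.choose_zero_pos _ (Nat.pos_of_ne_zero hk), zero_smul]

theorem coeff_dPow_mul (i : ℤ) (Q : PsiDO R) (n : ℤ) :
    (dPow i * Q).coeff n = ∑ᶠ k : ℕ, Ring.choose i k • (∂)^[k] (Q.coeff (n - i + k)) := by
  rw [← mono_one, coeff_mono_mul, one_mul]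

theorem coeff_dPow_one_mul (Q : PsiDO R) (n : ℤ) :
    (dPow 1 * Q).coeff n = Q.coeff (n - 1) + ∂ (Q.coeff n) := by
  rw [coeff_dPow_mul, finsum_eq_sum_of_support_subset (s := Finset.range 2)]
  · rw [Finset.sum_range_succ, Finset.sum_range_one]
    simp
  · intro k hk
    by_contra hc
    apply hk
    simp only [Finset.coe_range, Set.mem_Iio, not_lt] at hc
    have : Ring.choose (1 : ℤ) k = 0 := by
      have h := Ring.choose_natCast (R := ℤ) 1 k
      rw [Nat.cast_one] at h
      rw [h, Nat.choose_eq_zero_of_lt (by omega), Nat.cast_zero]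
    simp [this]

theorem coeff_mul_dPow (P : PsiDO R) (j n : ℤ) : (P * dPow j).coeff n = P.coeff (n - j) := by
  rw [coeff_mul, finsum_eq_single _ (n - j, 0)]
  · simp [coeff_dPow]
  · rintro ⟨i, k⟩ h
    dsimp only
    rw [coeff_dPow]
    split_ifs with hc
    · rcases k with _ | k
      · exact (h (Prod.ext (show i = n - j by simp only [Nat.cast_zero] at hc; omega) rfl)).elim
      · rw [Function.iterate_succ_apply, Derivation.map_one_eq_zero, iterate_map_zero]
        simp
    · simp [iterate_map_zero]

theorem finite_support_mul_coeff_shift (i : ℤ) (Q : PsiDO R) (n : ℤ) :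
    (Function.support fun k : ℕ => Ring.choose i k • (∂)^[k] (Q.coeff (n + k))).Finite := by
  obtain ⟨M, hM⟩ := Q.bounded
  refine (Finset.range (M - n + 1).toNat).finite_toSet.subset fun k hk => ?_
  by_contra hc
  apply hk
  simp only [Finset.coe_range, Set.mem_Iio] at hc
  dsimp only
  rw [hM _ (by omega), iterate_map_zero, smul_zero]

/-- Left multiplication by ∂ shifts the coefficients and adds their derivatives, so this is Pascal's
rule for the generalised binomial coefficients, valid for negative `i` too. -/
theorem dPow_one_mul_dPow_mul (i : ℤ) (Q : PsiDO R) :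
    dPow 1 * (dPow i * Q) = dPow (i + 1) * Q := by
  ext n
  rw [coeff_dPow_one_mul, coeff_dPow_mul, coeff_dPow_mul, coeff_dPow_mul]
  have e1 : n - (i + 1) = n - 1 - i := by ring
  rw [e1]
  have hs := finite_support_mul_coeff_shift i Q (n - i)
  rw [pascal_finsum i (fun k => (∂)^[k] (Q.coeff (n - 1 - i + k))),
    (show ∂ _ = _ from
      (Differential.deriv : Derivation ℤ R R).toLinearMap.toAddMonoidHom.map_finsum hs)]
  · congr 1
    refine finsum_congr fun k => ?_
    change ∂ (Ring.choose i k • (∂)^[k] (Q.coeff (n - i + k))) = _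
    rw [map_zsmul, Function.iterate_succ_apply', show n - 1 - i + ((k + 1 : ℕ) : ℤ) = n - i + k by
      push_cast; ring]
  · obtain ⟨M, hM⟩ := Q.bounded
    refine (Finset.range (M - (n - 1 - i) + 1).toNat).finite_toSet.subset fun k hk => ?_
    by_contra hc
    apply hk
    simp only [Finset.coe_range, Set.mem_Iio] at hc
    dsimp only
    rw [hM _ (by omega), iterate_map_zero]

/-- The coefficients of `Q` vanish one after the other from the top. This cancellation gives access
to negative powers of ∂. -/
theorem dPow_one_mul_injective (Q : PsiDO R) (h : dPow 1 * Q = 0) : Q = 0 := by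
  obtain ⟨N, hN⟩ := Q.bounded
  have key : ∀ k : ℕ, Q.coeff (N + 1 - k) = 0 := fun k => by
    induction k with
    | zero => exact hN _ (by simp)
    | succ k ih =>
      have h1 := coeff_dPow_one_mul Q (N + 1 - k)
      rw [h, ih, map_zero, add_zero, coeff_zero] at h1
      rw [h1]
      congr 1
      push_cast
      ring
  ext i
  rcases lt_or_ge N i with hi | hi
  · exact hN i hi
  · have := key (N + 1 - i).toNat
    rwa [Int.toNat_of_nonneg (by omega), sub_sub_cancel] at this

theorem mono_mul (a : R) (i : ℤ) (Q : PsiDO R) : mono a i * Q = mono a 0 * (dPow i * Q) := by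
  ext n
  rw [coeff_mono_mul, coeff_mono_zero_mul, coeff_dPow_mul]

/-- Additive operations of bounded order on operators are determined by their values on monomials. -/
theorem addHom_ext {F G : PsiDO R →+ PsiDO R} (c : ℤ)
    (hF : ∀ n P, OrderLE n P → OrderLE (n + c) (F P))
    (hG : ∀ n P, OrderLE n P → OrderLE (n + c) (G P))
    (h : ∀ a i, F (mono a i) = G (mono a i)) : F = G := by
  ext P n
  -- A remainder of order at most n - c - 1 cannot reach the coefficient n of its image under F or
  -- G.
  obtain ⟨s, Q, hQ, hP⟩ := exists_eq_sum_mono_add P (n - c - 1)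
  rw [hP, map_add, map_add, map_sum, map_sum, coeff_add, coeff_add,
    Finset.sum_congr rfl fun i _ => h _ i, hF _ _ hQ n (by omega), hG _ _ hQ n (by omega)]

theorem dPow_one_mul_mono_zero_mul (a : R) (Q : PsiDO R) :
    dPow 1 * (mono a 0 * Q) = mono (∂ a) 0 * Q + mono a 0 * (dPow 1 * Q) := by
  ext n
  simp only [coeff_dPow_one_mul, coeff_mono_zero_mul, coeff_add, Derivation.leibniz, smul_eq_mul]
  ring

theorem dPow_one_mul_mono (a : R) (i : ℤ) : dPow 1 * mono a i = mono (∂ a) i + mono a (i + 1) := by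
  ext n
  have e : n - 1 = i ↔ n = i + 1 := by omega
  simp only [coeff_dPow_one_mul, coeff_mono, coeff_add, e]
  split_ifs <;> first | omega | simp

/-- For Q = a ∂^i this is the Leibniz rule ∂ ∘ a = a' + a ∂; `addHom_ext` extends it to all Q. -/
theorem dPow_one_mul_mul (Q S : PsiDO R) : dPow 1 * (Q * S) = dPow 1 * Q * S := by
  obtain ⟨N, hN⟩ := S.exists_orderLE
  refine DFunLike.congr_fun (addHom_ext
    (F := (AddMonoidHom.mulLeft (dPow 1)).comp (AddMonoidHom.mulRight S))
    (G := (AddMonoidHom.mulRight S).comp (AddMonoidHom.mulLeft (dPow 1))) (1 + N) ?_ ?_ ?_) Q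
  · exact fun n P hP => ((orderLE_dPow 1).mul (hP.mul hN)).mono (by omega)
  · exact fun n P hP => (((orderLE_dPow 1).mul hP).mul hN).mono (by omega)
  · intro a i
    change dPow 1 * (mono a i * S) = dPow 1 * mono a i * S
    rw [dPow_one_mul_mono, add_mul, mono_mul, mono_mul _ i, mono_mul _ (i + 1),
      dPow_one_mul_mono_zero_mul, dPow_one_mul_dPow_mul]

theorem dPow_zero_mul (Q : PsiDO R) : dPow 0 * Q = Q := by
  rw [← mono_one]
  ext n
  rw [coeff_mono_zero_mul, one_mul]

theorem dPow_mul_mul (i : ℤ) (Q S : PsiDO R) : dPow i * (Q * S) = dPow i * Q * S := by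
  induction i with
  | zero => rw [dPow_zero_mul, dPow_zero_mul]
  | succ i ih => rw [← dPow_one_mul_dPow_mul, ← dPow_one_mul_dPow_mul, ih, dPow_one_mul_mul]
  | pred i ih =>
    rw [← sub_eq_zero]
    refine dPow_one_mul_injective _ ?_
    rw [mul_sub, sub_eq_zero, dPow_one_mul_dPow_mul, dPow_one_mul_mul, dPow_one_mul_dPow_mul,
      sub_add_cancel, ih]

theorem mono_zero_mul_mul (a : R) (Q S : PsiDO R) : mono a 0 * (Q * S) = mono a 0 * Q * S := by
  ext n
  rw [coeff_mono_zero_mul, coeff_mul, coeff_mul, ← smul_eq_mul,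
    smul_finsum' _ (finite_support_coeff_mul _ _ _)]
  refine finsum_congr fun p => ?_
  rw [coeff_mono_zero_mul, smul_eq_mul, mul_smul_comm, mul_assoc]

/-- Both sides are additive in P and of bounded order, so monomials a ∂^i suffice, and there the
factors a and ∂^i are pulled out separately. -/
theorem mul_assoc' (P Q S : PsiDO R) : P * Q * S = P * (Q * S) := by
  obtain ⟨N, hN⟩ := S.exists_orderLE
  obtain ⟨M, hM⟩ := Q.exists_orderLE
  refine DFunLike.congr_fun (addHom_ext
    (F := (AddMonoidHom.mulRight S).comp (AddMonoidHom.mulRight Q))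
    (G := AddMonoidHom.mulRight (Q * S)) (M + N) ?_ ?_ ?_) P
  · exact fun n P hP => ((hP.mul hM).mul hN).mono (by omega)
  · exact fun n P hP => (hP.mul (hM.mul hN)).mono (by omega)
  · intro a i
    change mono a i * Q * S = mono a i * (Q * S)
    rw [mono_mul, mono_mul _ _ (Q * S), ← mono_zero_mul_mul, dPow_mul_mul]

instance : Ring (PsiDO R) where
  mul_assoc := mul_assoc'
  one_mul := dPow_zero_mul
  mul_one P := by
    ext n
    change (P * dPow 0).coeff n = _
    rw [coeff_mul_dPow, sub_zero]
  zsmul := zsmulRec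
  neg_add_cancel := neg_add_cancel
  sub_eq_add_neg := sub_eq_add_neg
  npow r P := P ^ r
  npow_zero _ := rfl
  npow_succ _ _ := rfl

theorem dPow_mul_dPow (i j : ℤ) : (dPow i * dPow j : PsiDO R) = dPow (i + j) := by
  ext n
  rw [coeff_mul_dPow, coeff_dPow, coeff_dPow]
  congr 1
  exact propext (by omega)

/-- For n < 0 a term with both indices nonnegative has k > i ≥ 0, so its binomial coefficient is
zero. -/
theorem IsDifferential.mul {P Q : PsiDO R} (hP : IsDifferential P) (hQ : IsDifferential Q) :
    IsDifferential (P * Q) := fun n hn => by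
  rw [coeff_mul]
  refine finsum_eq_zero_of_forall_eq_zero fun ⟨i, k⟩ => ?_
  dsimp only
  rcases lt_or_ge i 0 with hi | hi
  · simp [hP i hi]
  · rcases lt_or_ge (n - i + k) 0 with h | h
    · simp [hQ _ h, iterate_map_zero]
    · lift i to ℕ using hi
      have := Ring.choose_natCast (R := ℤ) i k
      rw [show ((i : ℤ)) = (i : ℤ) from rfl] at this
      rw [this, Nat.choose_eq_zero_of_lt (by omega)]
      simp

/-- The leading coefficient of a composition. -/
theorem coeff_mul_of_orderLE {m n : ℤ} {P Q : PsiDO R} (hP : OrderLE m P) (hQ : OrderLE n Q) :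
    (P * Q).coeff (m + n) = P.coeff m * Q.coeff n := by
  rw [coeff_mul, finsum_eq_single _ (m, 0)]
  · simp
  · rintro ⟨i, k⟩ h
    dsimp only
    rcases lt_or_ge m i with hi | hi
    · simp [hP _ hi]
    · rcases lt_or_ge n (m + n - i + k) with h' | h'
      · simp [hQ _ h', iterate_map_zero]
      · exact absurd (Prod.ext (by dsimp only; omega) (by dsimp only; omega)) h

/-- Composition with an operator whose coefficients are killed by `∂` involves no derivatives. -/
theorem coeff_mul_of_deriv_eq_zero {P Q : PsiDO R} (hQ : ∀ i, ∂ (Q.coeff i) = 0) (n : ℤ) :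
    (P * Q).coeff n = ∑ᶠ i : ℤ, P.coeff i * Q.coeff (n - i) := by
  rw [coeff_mul, finsum_curry _ (finite_support_coeff_mul _ _ _)]
  refine finsum_congr fun i => ?_
  rw [finsum_eq_single _ 0]
  · simp
  · intro k hk
    obtain ⟨k, rfl⟩ := Nat.exists_eq_succ_of_ne_zero hk
    simp [Function.iterate_succ_apply, hQ, iterate_map_zero]

end Ring

end PsiDO

/-! ### Calculus of functions of infinitely many times. -/

section SmoothCalculus

variable {A : Type*} [NormedCommRing A] [NormedAlgebra ℝ A] {D : TimeDomain}

theorem SmoothFn.extendZero_coe (f : SmoothFn A D) (t : D.carrier) : extendZero f.1 t.1 = f.1 t :=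
  extendZero_apply _ t.2

/-- The value at `t` of the one-form `∑ b_k dt_k`. -/
def oneForm (b : ℕ+ → SmoothFn A D) (t : Times) : Times →ₗ[ℝ] A :=
  Finsupp.linearCombination ℝ fun k => extendZero (b k).1 t

theorem oneForm_apply (b : ℕ+ → SmoothFn A D) (t u : Times) :
    oneForm b t u = u.sum fun k r => r • extendZero (b k).1 t :=
  Finsupp.linearCombination_apply ℝ u

theorem oneForm_single (b : ℕ+ → SmoothFn A D) (t : Times) (k : ℕ+) (r : ℝ) :
    oneForm b t (Finsupp.single k r) = r • extendZero (b k).1 t :=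
  Finsupp.linearCombination_single ℝ r k

theorem SmoothFn.hasDerivAt_zero (f : SmoothFn A D) (t : D.carrier) (u : Times) :
    HasDerivAt (fun s : ℝ => extendZero f.1 (t.1 + s • u))
      (oneForm (fun k => timeDeriv A D k f) t.1 u) 0 := by
  -- `IsSmooth` tests linear maps only, so the base point `t` is reached through an additional
  -- coordinate, held at 1.
  let l : ℝ × (u.support → ℝ) →ₗ[ℝ] Times :=
    (LinearMap.toSpanSingleton ℝ Times t.1).coprod
      (∑ k : u.support, (Finsupp.lsingle (k : ℕ+)) ∘ₗ LinearMap.proj k)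
  have hl : ∀ c x, l (c, x) = c • t.1 + ∑ k : u.support, Finsupp.single (k : ℕ+) (x k) := fun c x => by
    simp [l]
  have hl0 : l (1, 0) = t.1 := by simp [hl]
  have hmem : ((1 : ℝ), (0 : u.support → ℝ)) ∈ l ⁻¹' D.carrier := by
    rw [Set.mem_preimage, hl0]; exact t.2
  have h := (((f.2.contDiffOn l).contDiffAt
    ((D.isOpen_preimage_of_finiteDimensional l).mem_nhds hmem)).differentiableAt
      (by simp)).hasFDerivAt
  set L := fderiv ℝ (fun v => extendZero f.1 (l v)) (1, 0)
  have hline : ∀ x : u.support → ℝ,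
      HasDerivAt (fun s : ℝ => extendZero f.1 (l (1, s • x))) (L (0, x)) 0 := fun x => by
    have h2 : HasDerivAt (fun s : ℝ => ((1 : ℝ), s • x)) ((0 : ℝ), x) 0 := by
      have := (hasDerivAt_const (0 : ℝ) (1 : ℝ)).prodMk ((hasDerivAt_id (0 : ℝ)).smul_const x)
      simpa using this
    have h' : HasFDerivAt (fun v => extendZero f.1 (l v)) L ((1 : ℝ), (0 : ℝ) • x) := by
      rwa [zero_smul]
    exact HasFDerivAt.comp_hasDerivAt (0 : ℝ) h' h2
  have hsingle : ∀ k : u.support, L (0, Pi.single k 1) = (timeDeriv A D k f).1 t := fun k => by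
    refine ((hline (Pi.single k 1)).congr_of_eventuallyEq ?_).unique
      (IsSmooth.hasDerivAt f.2 k t)
    refine Filter.Eventually.of_forall fun s => ?_
    dsimp only
    congr 1
    rw [hl, one_smul, Finset.sum_eq_single k]
    · simp
    · intro j _ hj
      simp [hj]
    · simp
  have hu : ∀ s : ℝ, l (1, s • fun k : u.support => u k) = t.1 + s • u := fun s => by
    rw [hl, one_smul]
    congr 1
    conv_rhs => rw [← u.sum_single]
    rw [Finsupp.sum, Finset.smul_sum, Finset.univ_eq_attach, ← Finset.sum_attach u.support]
    simp
  have hfin := hline (fun k : u.support => u k)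
  simp only [hu] at hfin
  convert hfin using 1
  have hdec : ((0 : ℝ), fun k : u.support => u k) =
      ∑ k : u.support, u k • ((0 : ℝ), (Pi.single k 1 : u.support → ℝ)) := by
    refine Prod.ext (by simp [Prod.fst_sum]) ?_
    ext j
    simp [Prod.snd_sum, Finset.sum_apply, Pi.single_apply]
  rw [hdec, map_sum, oneForm_apply, Finsupp.sum, ← Finset.sum_attach]
  refine Finset.sum_congr rfl fun k _ => ?_
  rw [map_smul, hsingle, extendZero_apply _ t.2]

theorem SmoothFn.hasFDerivAt (f : SmoothFn A D) {V : Type*} [NormedAddCommGroup V]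
    [NormedSpace ℝ V] [FiniteDimensional ℝ V] (l : V →ₗ[ℝ] Times) {v : V}
    (hv : l v ∈ D.carrier) :
    HasFDerivAt (fun v => extendZero f.1 (l v))
      (LinearMap.toContinuousLinearMap ((oneForm (fun k => timeDeriv A D k f) (l v)) ∘ₗ l)) v := by
  have h := (((f.2.contDiffOn l).contDiffAt
    ((D.isOpen_preimage_of_finiteDimensional l).mem_nhds hv)).differentiableAt
      (by simp)).hasFDerivAt
  refine h.congr_fderiv (ContinuousLinearMap.ext fun w => ?_)
  have h2 : HasDerivAt (fun s : ℝ => v + s • w) w 0 := by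
    have := ((hasDerivAt_id' (0 : ℝ)).smul_const w).const_add v
    rwa [one_smul] at this
  have h' : HasFDerivAt (fun v => extendZero f.1 (l v))
      (fderiv ℝ (fun v => extendZero f.1 (l v)) v) (v + (0 : ℝ) • w) := by
    rwa [zero_smul, add_zero]
  have h3 := HasFDerivAt.comp_hasDerivAt (0 : ℝ) h' h2
  simp only [Function.comp_def, map_add, map_smul] at h3
  exact h3.unique (SmoothFn.hasDerivAt_zero f ⟨l v, hv⟩ (l w))

theorem SmoothFn.hasDerivAt (f : SmoothFn A D) (t u : Times) {s : ℝ}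
    (hs : t + s • u ∈ D.carrier) :
    HasDerivAt (fun s : ℝ => extendZero f.1 (t + s • u))
      (oneForm (fun k => timeDeriv A D k f) (t + s • u) u) s := by
  have h := (SmoothFn.hasDerivAt_zero f ⟨_, hs⟩ u)
  rw [show (0 : ℝ) = s - s by ring] at h
  have h2 := h.comp_sub_const s s
  refine h2.congr_of_eventuallyEq (Filter.Eventually.of_forall fun x => ?_)
  dsimp only
  congr 1
  rw [sub_smul]
  abel

/-- The partial derivatives commute. -/
theorem timeDeriv_comm (j k : ℕ+) (f : SmoothFn A D) :
    timeDeriv A D j (timeDeriv A D k f) = timeDeriv A D k (timeDeriv A D j f) := by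
  ext t
  let l : ℝ × ℝ × ℝ →ₗ[ℝ] Times :=
    (LinearMap.toSpanSingleton ℝ Times t.1).coprod
      ((Finsupp.lsingle j).coprod (Finsupp.lsingle k))
  have hl1 : l (1, 0, 0) = t.1 := by simp [l]
  have hl2 : l (0, 1, 0) = Finsupp.single j 1 := by simp [l]
  have hl3 : l (0, 0, 1) = Finsupp.single k 1 := by simp [l]
  have ho := D.isOpen_preimage_of_finiteDimensional l
  have hmem : ((1 : ℝ), (0 : ℝ), (0 : ℝ)) ∈ l ⁻¹' D.carrier := by
    rw [Set.mem_preimage, hl1]; exact t.2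
  have hφ := (f.2.contDiffOn l).contDiffAt (ho.mem_nhds hmem)
  have hsymm := hφ.isSymmSndFDerivAt (by rw [minSmoothness_of_isRCLikeNormedField]; exact ENat.LEInfty.out) (0, 1, 0) (0, 0, 1)
  have key : ∀ (i : ℕ+) (w x : ℝ × ℝ × ℝ), l w = Finsupp.single i 1 →
      fderiv ℝ (fderiv ℝ fun v => extendZero f.1 (l v)) (1, 0, 0) x w =
        oneForm (fun k => timeDeriv A D k (timeDeriv A D i f)) t.1 (l x) := fun i w x hw => by
    have h1 : DifferentiableAt ℝ (fderiv ℝ fun v => extendZero f.1 (l v)) (1, 0, 0) :=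
      (hφ.fderiv_right (m := ∞) (by simp)).differentiableAt (by simp)
    have h2 := h1.hasFDerivAt.clm_apply (hasFDerivAt_const w _)
    have h3 := (SmoothFn.hasFDerivAt (timeDeriv A D i f) l hmem).congr_of_eventuallyEq
      (f₁ := fun v => fderiv ℝ (fun v => extendZero f.1 (l v)) v w) (by
        filter_upwards [ho.mem_nhds hmem] with v hv
        rw [(SmoothFn.hasFDerivAt f l hv).fderiv]
        simp [hw, oneForm_single, extendZero_apply _ (Set.mem_preimage.1 hv)])
    have h4 := DFunLike.congr_fun (h2.unique h3) x
    rw [hl1] at h4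
    simpa using h4
  rw [key k _ _ hl3, key j _ _ hl2, hl2, hl3, oneForm_single, oneForm_single, one_smul, one_smul,
    SmoothFn.extendZero_coe, SmoothFn.extendZero_coe] at hsymm
  exact hsymm

/-- A function whose partial derivatives vanish is constant. -/
theorem SmoothFn.exists_eq_const (f : SmoothFn A D) (hf : ∀ k, timeDeriv A D k f = 0) :
    ∃ a : A, ∀ t, f.1 t = a := by
  obtain ⟨t₀, ht₀, hstar⟩ := D.exists_center
  refine ⟨f.1 ⟨t₀, ht₀⟩, fun t => ?_⟩
  have hmem : ∀ s ∈ Set.Icc (0 : ℝ) 1, t₀ + s • (t.1 - t₀) ∈ D.carrier := fun s hs =>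
    hstar.add_smul_sub_mem t.2 hs.1 hs.2
  have hd : ∀ s ∈ Set.Icc (0 : ℝ) 1,
      HasDerivAt (fun s : ℝ => extendZero f.1 (t₀ + s • (t.1 - t₀))) 0 s := fun s hs => by
    have h := SmoothFn.hasDerivAt f t₀ (t.1 - t₀) (hmem s hs)
    convert h using 1
    rw [oneForm_apply]
    refine (Finset.sum_eq_zero fun k _ => ?_).symm
    dsimp only
    rw [hf, extendZero_apply _ (hmem s hs)]
    simp
  have h := constant_of_has_deriv_right_zero
    (fun s hs => (hd s hs).continuousAt.continuousWithinAt)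
    (fun s hs => (hd s (Set.Ico_subset_Icc_self hs)).hasDerivWithinAt) 1 (by simp)
  simp only [one_smul, zero_smul, add_zero, add_sub_cancel] at h
  rwa [extendZero_apply _ ht₀, extendZero_coe] at h

variable (D) in
/-- Constant functions. -/
def SmoothFn.const (a : A) : SmoothFn A D :=
  ⟨fun _ => a, fun n l => (contDiffOn_const (c := a)).congr fun v hv => by
    simp [extendZero_apply _ (Set.mem_preimage.1 hv)]⟩

theorem SmoothFn.timeDeriv_const (a : A) (k : ℕ+) : timeDeriv A D k (SmoothFn.const D a) = 0 := by
  ext t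
  refine ((hasDerivAt_const (0 : ℝ) a).congr_of_eventuallyEq ?_).deriv
  filter_upwards [eventually_mem k t] with s hs
  rw [extendZero_apply _ hs]
  rfl

/-- Poincaré lemma: a closed one-form on a star-shaped domain is exact. -/
theorem SmoothFn.exists_timeDeriv_eq [CompleteSpace A] (b : ℕ+ → SmoothFn A D)
    (hb : ∀ j k, timeDeriv A D j (b k) = timeDeriv A D k (b j)) :
    ∃ f : SmoothFn A D, ∀ k, timeDeriv A D k f = b k := by
  obtain ⟨t₀, ht₀, hstar⟩ := D.exists_center
  let f : D.carrier → A := fun t =>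
    ∫ s in (0 : ℝ)..1, oneForm b (AffineMap.lineMap t₀ t.1 s) (t.1 - t₀)
  -- The differential of the radial primitive comes first, on pullbacks whose range contains the
  -- centre; smoothness of `f` is then read off from this formula.
  have hfd : ∀ {V : Type} [NormedAddCommGroup V] [NormedSpace ℝ V] [FiniteDimensional ℝ V]
      (l : V →ₗ[ℝ] Times) (v₀ : V) (h₀ : l v₀ = t₀) (v : V) (hv : l v ∈ D.carrier),
      HasFDerivAt (fun v => extendZero f (l v))
        (LinearMap.toContinuousLinearMap ((oneForm b (l v)) ∘ₗ l)) v := by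
    intro V _ _ _ l v₀ h₀ v hv
    have ho := D.isOpen_preimage_of_finiteDimensional l
    let θ : V → V →L[ℝ] A := fun v => LinearMap.toContinuousLinearMap ((oneForm b (l v)) ∘ₗ l)
    have hθ_apply : ∀ x w, θ x w = (l w).sum fun k r => r • extendZero (b k).1 (l x) :=
      fun x w => oneForm_apply b (l x) (l w)
    have hθ : ContDiffOn ℝ ∞ θ (l ⁻¹' D.carrier) := by
      rw [contDiffOn_clm_apply]
      intro w
      simp only [hθ_apply, Finsupp.sum]
      exact ContDiffOn.sum fun k _ => ((b k).2.contDiffOn l).const_smul _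
    have hθd : ∀ x, l x ∈ D.carrier → HasFDerivAt θ (fderiv ℝ θ x) x := fun x hx =>
      ((hθ.contDiffAt (ho.mem_nhds hx)).differentiableAt (by simp)).hasFDerivAt
    have hθ' : ∀ x, l x ∈ D.carrier → ∀ y w, fderiv ℝ θ x y w =
        (l w).sum fun k r => (l y).sum fun j r' =>
          r • r' • extendZero (timeDeriv A D j (b k)).1 (l x) := fun x hx y w => by
      have h1 := (hθd x hx).clm_apply (hasFDerivAt_const w x)
      simp only [hθ_apply, Finsupp.sum] at h1
      have h2 := HasFDerivAt.fun_sum (u := (l w).support)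
        fun k _ => (SmoothFn.hasFDerivAt (b k) l hx).const_smul (l w k)
      have h3 := DFunLike.congr_fun (h1.unique h2) y
      simp only [add_apply, ContinuousLinearMap.comp_apply,
        zero_apply, map_zero, zero_add, ContinuousLinearMap.flip_apply,
        sum_apply, smul_apply,
        LinearMap.coe_toContinuousLinearMap', LinearMap.comp_apply, oneForm_apply] at h3
      rw [h3, Finsupp.sum]
      simp only [Finsupp.sum, Finset.smul_sum]
    have hsymm : ∀ x, l x ∈ D.carrier → ∀ y w, fderiv ℝ θ x y w = fderiv ℝ θ x w y :=
      fun x hx y w => by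
        rw [hθ' x hx, hθ' x hx, Finsupp.sum_comm]
        simp only [Finsupp.sum]
        refine Finset.sum_congr rfl fun j _ => Finset.sum_congr rfl fun k _ => ?_
        rw [hb, smul_comm]
    have hstar' : ∀ w, l w ∈ D.carrier → ∀ x ∈ segment ℝ v₀ w, l x ∈ D.carrier := by
      rintro w hw _ ⟨p, q, hp, hq, hpq, rfl⟩
      rw [map_add, map_smul, map_smul, h₀]
      exact hstar hw hp hq hpq
    -- The integration theorem asks for a convex set and the domain is only star-shaped. The join of
    -- `v₀` with a small ball around `v` is convex, stays in the domain and is a neighbourhood of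
    -- `v`.
    obtain ⟨ε, hε, hball⟩ := Metric.isOpen_iff.1 ho v hv
    have hvb : v ∈ Metric.ball v ε := Metric.mem_ball_self hε
    have hsub : ∀ x ∈ convexJoin ℝ {v₀} (Metric.ball v ε), l x ∈ D.carrier := by
      intro x hx
      obtain ⟨_, rfl, w, hw, hx⟩ := mem_convexJoin.1 hx
      exact hstar' w (hball hw) x hx
    have hsubset : Metric.ball v ε ⊆ convexJoin ℝ {v₀} (Metric.ball v ε) := fun x hx =>
      mem_convexJoin.2 ⟨v₀, rfl, x, hx, right_mem_segment ℝ v₀ x⟩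
    have hint := ((convex_singleton v₀).convexJoin
      (convex_ball v ε)).hasFDerivWithinAt_curveIntegral_segment_of_hasFDerivWithinAt_symmetric
        (fun x hx => (hθd x (hsub x hx)).hasFDerivWithinAt)
        (fun x hx y _ w _ => hsymm x (hsub x hx) y w)
        (mem_convexJoin.2 ⟨v₀, rfl, v, hvb, left_mem_segment ℝ v₀ v⟩) (hsubset hvb)
    refine (hint.hasFDerivAt (Filter.mem_of_superset (Metric.ball_mem_nhds v hε)
      hsubset)).congr_of_eventuallyEq ?_
    filter_upwards [ho.mem_nhds hv] with w hw
    rw [extendZero_apply _ hw, curveIntegral_segment]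
    refine intervalIntegral.integral_congr fun s _ => ?_
    simp [θ, AffineMap.lineMap_apply, h₀]
  have hsmooth : IsSmooth f := by
    intro n l
    -- The extra coordinate puts the centre into the range, as `hfd` requires.
    let l' : (Fin n → ℝ) × ℝ →ₗ[ℝ] Times := l.coprod (LinearMap.toSpanSingleton ℝ Times t₀)
    have hl' : ∀ v, l' (v, 0) = l v := fun v => by simp [l']
    have ho := D.isOpen_preimage_of_finiteDimensional l'
    have h1 : ContDiffOn ℝ ∞ (fun v => extendZero f (l' v)) (l' ⁻¹' D.carrier) := by
      rw [contDiffOn_infty_iff_fderiv_of_isOpen ho]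
      have hd := hfd l' (0, 1) (by simp [l'])
      refine ⟨fun v hv => (hd v hv).differentiableAt.differentiableWithinAt, ?_⟩
      refine ContDiffOn.congr ?_ fun v hv => (hd v hv).fderiv
      rw [contDiffOn_clm_apply]
      intro w
      simp only [LinearMap.coe_toContinuousLinearMap', LinearMap.comp_apply, oneForm_apply,
        Finsupp.sum]
      exact ContDiffOn.sum fun k _ => ((b k).2.contDiffOn l').const_smul _
    refine (h1.comp (s := l ⁻¹' D.carrier) (g := fun v => extendZero f (l' v))
      (f := fun v => (v, (0 : ℝ))) (by fun_prop) fun v hv => ?_).congr fun v _ => ?_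
    · simpa [hl'] using hv
    · simp [hl']
  refine ⟨⟨f, hsmooth⟩, fun k => ?_⟩
  ext t
  let l : ℝ × ℝ × ℝ →ₗ[ℝ] Times :=
    (LinearMap.toSpanSingleton ℝ Times t.1).coprod
      ((LinearMap.toSpanSingleton ℝ Times t₀).coprod (Finsupp.lsingle k))
  have hl : l (1, 0, 0) = t.1 := by simp [l]
  have h := hfd l (0, 1, 0) (by simp [l]) (1, 0, 0) (by rw [hl]; exact t.2)
  have h2 := h.unique (SmoothFn.hasFDerivAt ⟨f, hsmooth⟩ l (by rw [hl]; exact t.2))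
  have h3 := DFunLike.congr_fun h2 (0, 0, 1)
  have hl3 : l (0, 0, 1) = Finsupp.single k 1 := by simp [l]
  simp only [LinearMap.coe_toContinuousLinearMap', LinearMap.comp_apply, hl, hl3, oneForm_single,
    one_smul, SmoothFn.extendZero_coe] at h3
  exact h3.symm

variable (D) in
/-- The linear function `∑ C_k t_k`. -/
def SmoothFn.linear (C : ℕ+ → A) : SmoothFn A D :=
  ⟨fun t => t.1.sum fun k s => s • C k, fun n l => by
    have h : ContDiffOn ℝ ∞
        (LinearMap.toContinuousLinearMap (Finsupp.linearCombination ℝ C ∘ₗ l)) (l ⁻¹' D.carrier) :=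
      ContinuousLinearMap.contDiff _ |>.contDiffOn
    refine h.congr fun v hv => ?_
    rw [extendZero_apply _ (Set.mem_preimage.1 hv)]
    exact (Finsupp.linearCombination_apply ℝ (l v)).symm⟩

theorem SmoothFn.linear_apply (C : ℕ+ → A) (t : D.carrier) :
    (SmoothFn.linear D C).1 t = t.1.sum fun k s => s • C k := rfl

theorem SmoothFn.timeDeriv_linear (C : ℕ+ → A) (k : ℕ+) :
    timeDeriv A D k (SmoothFn.linear D C) = SmoothFn.const D (C k) := by
  ext t
  have h : HasDerivAt (fun s : ℝ => Finsupp.linearCombination ℝ C t.1 + s • C k) (C k) 0 := by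
    have := ((hasDerivAt_id' (0 : ℝ)).smul_const (C k)).const_add
      (Finsupp.linearCombination ℝ C t.1)
    rwa [one_smul] at this
  refine (h.congr_of_eventuallyEq ?_).deriv
  filter_upwards [eventually_mem k t] with s hs
  rw [extendZero_apply _ hs, SmoothFn.linear_apply, ← Finsupp.linearCombination_apply ℝ, map_add,
    Finsupp.linearCombination_single]

/-- The exponential of a smooth function. -/
def SmoothFn.exp [CompleteSpace A] (f : SmoothFn A D) : SmoothFn A D :=
  ⟨fun t => NormedSpace.exp (f.1 t), fun n l => by
    have h : ContDiff ℝ ∞ (NormedSpace.exp : A → A) :=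
      AnalyticOnNhd.contDiff fun x _ => NormedSpace.exp_analytic x
    refine (h.comp_contDiffOn (f.2 n l)).congr fun v hv => ?_
    simp [extendZero_apply _ (Set.mem_preimage.1 hv)]⟩

variable [CompleteSpace A]

theorem SmoothFn.exp_apply (f : SmoothFn A D) (t : D.carrier) :
    (SmoothFn.exp f).1 t = NormedSpace.exp (f.1 t) := rfl

theorem SmoothFn.timeDeriv_exp (f : SmoothFn A D) (k : ℕ+) :
    timeDeriv A D k (SmoothFn.exp f) = timeDeriv A D k f * SmoothFn.exp f := by
  ext t
  have h := IsSmooth.hasDerivAt f.2 k t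
  have h0 : extendZero f.1 (t.1 + Finsupp.single k 0) = f.1 t := by
    rw [Finsupp.single_zero, add_zero, SmoothFn.extendZero_coe]
  have h2 : HasFDerivAt (NormedSpace.exp : A → A)
      (NormedSpace.exp (f.1 t) • (1 : A →L[ℝ] A)) (extendZero f.1 (t.1 + Finsupp.single k 0)) := by
    rw [h0]
    exact hasFDerivAt_exp
  refine ((HasFDerivAt.comp_hasDerivAt (0 : ℝ) h2 h).congr_of_eventuallyEq ?_).deriv.trans ?_
  · filter_upwards [eventually_mem k t] with s hs
    simp [extendZero_apply _ hs, SmoothFn.exp_apply]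
  · change NormedSpace.exp (f.1 t) * _ = _ * NormedSpace.exp (f.1 t)
    exact mul_comm _ _

theorem SmoothFn.exp_mul_exp_neg (f : SmoothFn A D) : SmoothFn.exp f * SmoothFn.exp (-f) = 1 := by
  ext t
  let _ : NormedAlgebra ℚ A := NormedAlgebra.restrictScalars ℚ ℝ A
  change NormedSpace.exp (f.1 t) * NormedSpace.exp (-f.1 t) = 1
  rw [← NormedSpace.exp_add, add_neg_cancel, NormedSpace.exp_zero]

/-- The exponential of a smooth function as a unit. -/
def SmoothFn.expUnit (f : SmoothFn A D) : (SmoothFn A D)ˣ where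
  val := SmoothFn.exp f
  inv := SmoothFn.exp (-f)
  val_inv := SmoothFn.exp_mul_exp_neg f
  inv_val := by rw [mul_comm, SmoothFn.exp_mul_exp_neg f]

theorem SmoothFn.val_expUnit (f : SmoothFn A D) : (SmoothFn.expUnit f : SmoothFn A D) = SmoothFn.exp f := rfl

end SmoothCalculus

/-! ### The Miwa shift as the kernel of a derivation. -/

namespace MiwaShift

open PowerSeries Finset

section

variable {R : Type*} [CommRing R]

theorem coeff_zero_mul (F G : PowerSeries R) : coeff 0 (F * G) = coeff 0 F * coeff 0 G := by
  simp [coeff_mul]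

theorem coeff_X_mul_derivative (F : PowerSeries R) (n : ℕ) :
    coeff n (X * derivative R F) = n * coeff n F := by
  cases n with
  | zero => simp
  | succ n => rw [coeff_succ_X_mul, coeff_derivative]; push_cast; ring

end

variable {R : Type*} [CommRing R] [Algebra ℝ R]

/-- A derivation applied to every coefficient of a power series. -/
def mapDer (d : Derivation ℝ R R) : Derivation ℝ (PowerSeries R) (PowerSeries R) :=
  Derivation.mk'
    { toFun := fun F => PowerSeries.mk fun n => d (coeff n F)
      map_add' := fun F G => by ext n; simp
      map_smul' := fun r F => by ext n; simp }
    (by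
      intro F G
      ext n
      simp only [LinearMap.coe_mk, AddHom.coe_mk, coeff_mk, coeff_mul, map_sum, map_add,
        Derivation.leibniz, smul_eq_mul, Finset.sum_add_distrib]
      rw [← Finset.Nat.sum_antidiagonal_swap (n := n)
        (f := fun p => coeff p.1 G * d (coeff p.2 F))]
      simp)

theorem coeff_mapDer (d : Derivation ℝ R R) (F : PowerSeries R) (n : ℕ) :
    coeff n (mapDer d F) = d (coeff n F) :=
  coeff_mk n fun n => d (coeff n F)

theorem mapDer_C (d : Derivation ℝ R R) (f : R) : mapDer d (C f) = C (d f) := by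
  ext n
  rw [coeff_mapDer, coeff_C, coeff_C]
  split_ifs <;> simp

variable (δ : ℕ+ → Derivation ℝ R R)

/-- The derivations `δ_k`, with `δ_0 = 0`. -/
def natDer : ℕ → Derivation ℝ R R
  | 0 => 0
  | k + 1 => δ k.succPNat

theorem natDer_zero : natDer δ 0 = 0 := rfl

theorem natDer_pnat (k : ℕ+) : natDer δ k = δ k := by
  conv_rhs => rw [← PNat.succPNat_natPred k]
  rw [← PNat.natPred_add_one k]
  rfl

theorem natDer_mapDer (k : ℕ) :
    natDer (fun k => mapDer (δ k)) k = mapDer (natDer δ k) := by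
  cases k with
  | zero => ext F n; simp [coeff_mapDer, natDer_zero]
  | succ k => rfl

theorem natDer_comm (hδ : ∀ j k f, δ j (δ k f) = δ k (δ j f)) (j k : ℕ) (f : R) :
    natDer δ j (natDer δ k f) = natDer δ k (natDer δ j f) := by
  cases j with
  | zero => simp [natDer_zero]
  | succ j =>
    cases k with
    | zero => simp [natDer_zero]
    | succ k => exact hδ _ _ f

/-- The operator `∑_k X^k δ_k` on power series. -/
def flowSum (F : PowerSeries R) : PowerSeries R :=
  PowerSeries.mk fun n => ∑ p ∈ antidiagonal n, natDer δ p.1 (coeff p.2 F)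

/-- In each degree the infinite sum is a finite combination of derivations; the Leibniz rule for
`flow` is inherited from these truncations. -/
theorem coeff_flowSum_eq {n B : ℕ} (h : n < B) (F : PowerSeries R) :
    coeff n (flowSum δ F) = coeff n (∑ k ∈ range B, X ^ k * mapDer (natDer δ k) F) := by
  rw [flowSum, coeff_mk, Finset.Nat.sum_antidiagonal_eq_sum_range_succ
    (fun k m => natDer δ k (coeff m F)), map_sum]
  refine (Finset.sum_subset_zero_on_sdiff (fun k hk => ?_) (fun k hk => ?_) fun k hk => ?_)
  · simp only [mem_range] at hk ⊢; omega
  · simp only [mem_sdiff, mem_range] at hk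
    rw [coeff_X_pow_mul', if_neg (by omega)]
  · simp only [mem_range] at hk
    rw [coeff_X_pow_mul', if_pos (by omega), coeff_mapDer]

/-- The derivation `X d/dX + ∑_k X^k δ_k` of the power series ring. -/
def flow : Derivation ℝ (PowerSeries R) (PowerSeries R) :=
  Derivation.mk'
    { toFun := fun F => X * derivative R F + flowSum δ F
      map_add' := fun F G => by
        ext n
        simp only [flowSum, map_add, mul_add, coeff_mk, sum_add_distrib]
        ring
      map_smul' := fun r F => by
        ext n
        simp [coeff_X_mul_derivative, flowSum, smul_sum] }
    (by
      intro F G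
      have h : flowSum δ (F * G) = F * flowSum δ G + G * flowSum δ F := by
        ext n
        have key : ∀ F G : PowerSeries R, coeff n (F * flowSum δ G) =
            coeff n (F * ∑ k ∈ range (n + 1), X ^ k * mapDer (natDer δ k) G) := fun F G => by
          rw [coeff_mul, coeff_mul]
          refine sum_congr rfl fun p hp => ?_
          rw [coeff_flowSum_eq δ (B := n + 1) (by have := HasAntidiagonal.mem_antidiagonal.1 hp; omega)]
        rw [map_add, key, key, coeff_flowSum_eq δ n.lt_succ_self, ← map_add]
        congr 1
        simp only [Derivation.leibniz, smul_eq_mul, mul_sum, ← sum_add_distrib]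
        exact sum_congr rfl fun k _ => by ring
      simp only [LinearMap.coe_mk, AddHom.coe_mk, h, Derivation.leibniz, smul_eq_mul]
      ring)

theorem coeff_flow (F : PowerSeries R) (n : ℕ) :
    coeff n (flow δ F) = n * coeff n F + ∑ p ∈ antidiagonal n, natDer δ p.1 (coeff p.2 F) := by
  change coeff n (X * derivative R F + flowSum δ F) = _
  rw [map_add, flowSum, coeff_mk, coeff_X_mul_derivative]

theorem flow_C (f : R) : flow δ (C f) = PowerSeries.mk fun k => natDer δ k f := by
  ext n
  rw [coeff_flow, coeff_mk, sum_eq_single (n, 0)]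
  · cases n <;> simp [coeff_C]
  · rintro ⟨k, m⟩ h1 h2
    have : m ≠ 0 := fun h => h2 (by
      rw [HasAntidiagonal.mem_antidiagonal] at h1; subst h; simpa using h1)
    simp [coeff_C, this]
  · simp

theorem flow_map {S : Type*} [CommRing S] [Algebra ℝ S] (ε : ℕ+ → Derivation ℝ S S) (φ : R →+* S)
    (hφ : ∀ k f, φ (δ k f) = ε k (φ f)) (F : PowerSeries R) :
    flow ε (PowerSeries.map φ F) = PowerSeries.map φ (flow δ F) := by
  have hφ' : ∀ k f, φ (natDer δ k f) = natDer ε k (φ f) := fun k f => by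
    cases k with
    | zero => simp [natDer_zero]
    | succ k => exact hφ _ f
  ext n
  simp only [coeff_flow, coeff_map, map_add, map_mul, map_natCast, map_sum, hφ']

theorem flow_mapDer (hδ : ∀ j k f, δ j (δ k f) = δ k (δ j f)) (k : ℕ+) (F : PowerSeries R) :
    flow δ (mapDer (δ k) F) = mapDer (δ k) (flow δ F) := by
  have h := natDer_comm δ hδ
  ext n
  rw [coeff_mapDer, coeff_flow, coeff_flow, map_add, map_sum, Derivation.leibniz,
    Derivation.map_natCast, smul_zero, add_zero, smul_eq_mul, coeff_mapDer]
  congr 1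
  refine sum_congr rfl fun p _ => ?_
  rw [coeff_mapDer, ← natDer_pnat δ k, h]

/-- Uniqueness for first-order linear equations with a vanishing initial value. -/
theorem eq_zero_of_flow_eq_mul {c F : PowerSeries R} (hc : coeff 0 c = 0) (hF : coeff 0 F = 0)
    (h : flow δ F = c * F) : F = 0 := by
  ext n
  induction n using Nat.strong_induction_on with
  | _ n ih =>
    rcases Nat.eq_zero_or_pos n with rfl | hn
    · exact hF
    -- All other terms of degree n contain lower coefficients of F, because `c` has no constant term
    -- and `natDer δ 0` is zero. What remains is n F_n = 0, and n is invertible in an ℝ-algebra.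
    have h1 := congrArg (coeff n) h
    rw [coeff_flow, coeff_mul, sum_eq_zero, sum_eq_zero, add_zero] at h1
    · have h2 : ((n : ℝ)⁻¹ * n) • coeff n F = 0 := by
        rw [mul_smul, Nat.cast_smul_eq_nsmul, nsmul_eq_mul, h1, smul_zero]
      rwa [inv_mul_cancel₀ (by positivity), one_smul] at h2
    · rintro ⟨i, j⟩ hp
      have hp := HasAntidiagonal.mem_antidiagonal.1 hp
      rcases Nat.eq_zero_or_pos i with rfl | hi
      · dsimp only; rw [hc, zero_mul]
      · dsimp only; rw [ih j (by simp only at hp; omega), map_zero, mul_zero]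
    · rintro ⟨i, j⟩ hp
      have hp := HasAntidiagonal.mem_antidiagonal.1 hp
      rcases Nat.eq_zero_or_pos i with rfl | hi
      · simp [natDer_zero]
      · dsimp only; rw [ih j (by simp only at hp; omega), map_zero, map_zero]

theorem eq_of_flow_eq_mul {c F G : PowerSeries R} (hc : coeff 0 c = 0)
    (h0 : coeff 0 F = coeff 0 G) (hF : flow δ F = c * F) (hG : flow δ G = c * G) : F = G := by
  rw [← sub_eq_zero]
  exact eq_zero_of_flow_eq_mul δ hc (by rw [map_sub, h0, sub_self])
    (by rw [map_sub, hF, hG, mul_sub])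

/-- `G` is the formal Miwa shift of the derivations `δ_k`: `G f` is the power series with constant
term `f` that is annihilated by `X d/dX + ∑_k X^k δ_k`. -/
structure IsShift (G : R → PowerSeries R) : Prop where
  coeff_zero : ∀ f, coeff 0 (G f) = f
  flow_eq_zero : ∀ f, flow δ (G f) = 0

namespace IsShift

variable {δ} {G : R → PowerSeries R}

/-- Uniqueness for the homogeneous equation. Multiplicativity of G, its commutation with the
derivations and its effect on constants all come from here. -/
theorem ext_of_flow (hG : IsShift δ G) {F : PowerSeries R} {f : R} (h0 : coeff 0 F = f) (hF : flow δ F = 0) :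
    F = G f :=
  eq_of_flow_eq_mul δ (c := 0) (map_zero _) (by rw [h0, hG.coeff_zero]) (by rw [hF, zero_mul])
    (by rw [hG.flow_eq_zero, zero_mul])

/-- The Miwa shift as a ring homomorphism. -/
def toRingHom (hG : IsShift δ G) : R →+* PowerSeries R where
  toFun := G
  map_one' := (hG.ext_of_flow (by simp) (Derivation.map_one_eq_zero _)).symm
  map_mul' f g := (hG.ext_of_flow (by
    rw [coeff_zero_mul, hG.coeff_zero, hG.coeff_zero]) (by
    simp [Derivation.leibniz, hG.flow_eq_zero])).symm
  map_zero' := (hG.ext_of_flow (by simp) (map_zero _)).symm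
  map_add' f g := (hG.ext_of_flow (by
    rw [map_add, hG.coeff_zero, hG.coeff_zero]) (by
    rw [map_add, hG.flow_eq_zero, hG.flow_eq_zero, add_zero])).symm

theorem toRingHom_apply (hG : IsShift δ G) (f : R) : hG.toRingHom f = G f := rfl

theorem map_one (hG : IsShift δ G) : G 1 = 1 := hG.toRingHom.map_one

theorem map_mul (hG : IsShift δ G) (f g : R) : G (f * g) = G f * G g := hG.toRingHom.map_mul f g

theorem map_der (hG : IsShift δ G) (hδ : ∀ j k f, δ j (δ k f) = δ k (δ j f)) (k : ℕ+) (f : R) :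
    G (δ k f) = mapDer (δ k) (G f) :=
  (hG.ext_of_flow (by rw [coeff_mapDer, hG.coeff_zero]) (by
    rw [flow_mapDer δ hδ, hG.flow_eq_zero, map_zero])).symm

theorem map_const (hG : IsShift δ G) {f : R} (hf : ∀ k, δ k f = 0) : G f = C f :=
  (hG.ext_of_flow (by simp) (by
    rw [flow_C]
    ext n
    cases n with
    | zero => simp [natDer_zero]
    | succ n =>
      rw [coeff_mk, _root_.map_zero]
      exact hf n.succPNat)).symm

theorem natCast_mul_coeff (hG : IsShift δ G) (f : R) (n : ℕ) :
    (n : R) * coeff n (G f) = -∑ p ∈ antidiagonal n, natDer δ p.1 (coeff p.2 (G f)) := by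
  have h := congrArg (coeff n) (hG.flow_eq_zero f)
  rw [coeff_flow, _root_.map_zero] at h
  exact eq_neg_of_add_eq_zero_left h

theorem coeff_one (hG : IsShift δ G) (f : R) : coeff 1 (G f) = -δ 1 f := by
  have h := hG.natCast_mul_coeff f 1
  rw [Nat.cast_one, one_mul, Finset.Nat.antidiagonal_succ] at h
  simp only [Finset.Nat.antidiagonal_zero, map_singleton, cons_eq_insert] at h
  rw [h, sum_insert (by simp), sum_singleton]
  simp [natDer_zero, hG.coeff_zero, ← natDer_pnat δ 1]

end IsShift

end MiwaShift

/-! ### The Fay relations and the closed form d log τ. -/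

namespace MiwaShift

open PowerSeries Finset

section Swap

variable {R : Type*} [CommRing R]

/-- Interchange of the two variables of `R⟦X⟧⟦Y⟧`. -/
def swap : PowerSeries (PowerSeries R) →+* PowerSeries (PowerSeries R) where
  toFun F := PowerSeries.mk fun m => PowerSeries.mk fun n => coeff m (coeff n F)
  map_one' := by
    ext m n
    simp only [coeff_mk, PowerSeries.coeff_one]
    split_ifs <;> simp_all [PowerSeries.coeff_one]
  map_mul' F G := by
    ext m n
    simp only [coeff_mk, coeff_mul, map_sum]
    exact Finset.sum_comm
  map_zero' := by ext m n; simp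
  map_add' F G := by ext m n; simp

theorem coeff_swap (F : PowerSeries (PowerSeries R)) (m n : ℕ) :
    coeff n (coeff m (swap F)) = coeff m (coeff n F) := by
  change coeff n (coeff m (PowerSeries.mk fun m => PowerSeries.mk fun n => coeff m (coeff n F))) = _
  rw [coeff_mk, coeff_mk]

theorem swap_X : swap (X : PowerSeries (PowerSeries R)) = C X := by
  ext m n
  rw [coeff_swap, coeff_C, coeff_X]
  split_ifs <;> simp_all [coeff_X, PowerSeries.coeff_one]

theorem swap_C (F : PowerSeries R) : swap (C F) = PowerSeries.map C F := by
  ext m n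
  rw [coeff_swap, coeff_C, coeff_map, coeff_C]
  split_ifs <;> simp

theorem swap_map_C (F : PowerSeries R) : swap (PowerSeries.map C F) = C F := by
  ext m n
  rw [coeff_swap, coeff_C, coeff_map, coeff_C]
  split_ifs <;> simp

theorem eq_zero_of_X_sub_C_X_mul (F : PowerSeries (PowerSeries R)) (h : (X - C X) * F = 0) :
    F = 0 := by
  have key : ∀ n, coeff n F = 0 := fun n => by
    have hX : ∀ f : PowerSeries R, X * f = 0 → f = 0 := fun f hf => by
      ext m
      rw [← coeff_succ_X_mul, hf, map_zero, map_zero]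
    induction n with
    | zero =>
      have h1 := congrArg (coeff 0) h
      rw [sub_mul, map_sub, coeff_zero_X_mul, coeff_C_mul, zero_sub, map_zero, neg_eq_zero] at h1
      exact hX _ h1
    | succ n ih =>
      have h1 := congrArg (coeff (n + 1)) h
      rw [sub_mul, map_sub, coeff_succ_X_mul, coeff_C_mul, ih, zero_sub, map_zero,
        neg_eq_zero] at h1
      exact hX _ h1
  ext1 n
  rw [key, map_zero]

end Swap

variable {R : Type*} [CommRing R] [Algebra ℝ R] {δ : ℕ+ → Derivation ℝ R R}
  {G : R → PowerSeries R}

/-- The consequences of the bilinear identity for the series `W = 1 + W₁ X + W₂ X² + ⋯` that involve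
one Miwa shift. -/
def SatisfiesFay (G : R → PowerSeries R) (W : PowerSeries R) : Prop :=
  ∀ n m, coeff (n + 2) (G (coeff m W)) - coeff (n + 1) (G (coeff (m + 1) W)) =
    -(coeff (n + 1) (G (coeff 1 W)) * coeff m W)

variable {W : PowerSeries R}

/-- Summed along n + m = M the Fay relations telescope. One end is a positive coefficient of G 1 =
1, hence zero; the other is the first coefficient of G W_{M+1}, which is -δ₁ W_{M+1}. -/
theorem SatisfiesFay.mapDer_one (hG : IsShift δ G) (hW0 : coeff 0 W = 1) (hW : SatisfiesFay G W) :
    mapDer (δ 1) W = -((G (coeff 1 W) - C (coeff 1 W)) * W) := by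
  ext M
  have h1 : ∀ n, coeff (n + 1) (G 1) = 0 := fun n => by
    rw [hG.map_one, PowerSeries.coeff_one, if_neg n.succ_ne_zero]
  cases M with
  | zero =>
    rw [coeff_mapDer, hW0, Derivation.map_one_eq_zero, map_neg, coeff_zero_mul, map_sub,
      hG.coeff_zero, coeff_zero_C, sub_self, zero_mul, neg_zero]
  | succ M =>
    rw [map_neg, coeff_mul, Finset.Nat.sum_antidiagonal_succ, map_sub, hG.coeff_zero, coeff_zero_C,
      sub_self, zero_mul, zero_add, Finset.Nat.sum_antidiagonal_eq_sum_range_succ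
      (fun i j => coeff (i + 1) (G (coeff 1 W) - C (coeff 1 W)) * coeff j W), coeff_mapDer]
    have h2 : ∀ n ∈ range (M + 1),
        coeff (n + 1) (G (coeff 1 W) - C (coeff 1 W)) * coeff (M - n) W =
        coeff (n + 1) (G (coeff (M + 1 - n) W)) -
          coeff (n + 1 + 1) (G (coeff (M + 1 - (n + 1)) W)) := fun n hn => by
      have hn : n ≤ M := by simpa [Nat.lt_succ_iff] using hn
      have h := hW n (M - n)
      rw [show M - n + 1 = M + 1 - n by omega] at h
      rw [map_sub, coeff_C, if_neg n.succ_ne_zero, sub_zero, Nat.succ_sub_succ]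
      linear_combination h
    rw [sum_congr rfl h2, sum_range_sub' (fun n => coeff (n + 1) (G (coeff (M + 1 - n) W)))]
    simp [hW0, h1, hG.coeff_one]

/-- The symmetry `Ŵ(X) G(X)Ŵ(Y) = Ŵ(Y) G(Y)Ŵ(X)`. -/
theorem SatisfiesFay.symm (hG : IsShift δ G) (hW0 : coeff 0 W = 1) (hW : SatisfiesFay G W) :
    C W * PowerSeries.map hG.toRingHom W =
      PowerSeries.map C W * swap (PowerSeries.map hG.toRingHom W) := by
  set P := PowerSeries.map hG.toRingHom W with hP
  set u := G (coeff 1 W) - C (coeff 1 W) with hu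
  have h1 : ∀ n, coeff n (G 1) = if n = 0 then 1 else 0 := fun n => by
    rw [hG.map_one, PowerSeries.coeff_one]
  -- The Fay relations as one identity. With Y for the outer variable and X for the inner one, `P`
  -- is G(X)W(Y), and (Y - X) G(X)W(Y) = (Y - X) W(Y) - XY (δ₁W(Y) + u(X) W(Y)).
  have hfay : (X - C X) * P = (X - C X) * PowerSeries.map C W -
      C X * X * (PowerSeries.map C (mapDer (δ 1) W) + C u * PowerSeries.map C W) := by
    ext m n
    have e : C X * X * (PowerSeries.map C (mapDer (δ 1) W) + C u * PowerSeries.map C W) =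
        X * (C X * (PowerSeries.map C (mapDer (δ 1) W) + C u * PowerSeries.map C W)) := by ring
    rw [e]
    simp only [sub_mul, map_sub]
    rcases m with _ | m
    · simp only [coeff_zero_X_mul, coeff_C_mul, hP, coeff_map, hW0, hG.toRingHom_apply, map_zero,
        zero_sub, hG.map_one, RingHom.map_one, sub_zero]
    · simp only [coeff_succ_X_mul, coeff_C_mul, hP, coeff_map, hG.toRingHom_apply, map_add,
        coeff_mapDer]
      rcases n with _ | n
      · simp only [coeff_zero_X_mul, hG.coeff_zero, coeff_zero_C, sub_zero]
      · simp only [coeff_succ_X_mul, coeff_mul_C, map_add]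
        rcases n with _ | n
        · have hC : coeff 1 (C (coeff m W)) = 0 := by rw [coeff_C, if_neg one_ne_zero]
          simp only [hu, hC, hG.coeff_zero, hG.coeff_one, coeff_zero_C, coeff_one_X, map_sub,
            zero_add]
          ring
        · have h := hW n m
          have hX : coeff (n + 1 + 1) (X : PowerSeries R) = 0 := by
            rw [coeff_X, if_neg (by omega)]
          simp only [hu, hX, map_sub, coeff_C, if_neg (Nat.succ_ne_zero _)]
          linear_combination h
  have hder := hW.mapDer_one hG hW0
  have hder' : C W * C u = -C (mapDer (δ 1) W) := by
    rw [hder, ← map_mul, ← map_neg, neg_neg, mul_comm]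
  -- After multiplication by W(X), `hder'` turns u(X)W(X) into -δ₁W(X), and the right-hand side
  -- becomes antisymmetric in X and Y. So does the left; since Y - X is antisymmetric and
  -- cancellable, the symmetry follows.
  have hanti : (X - C X) * (C W * P) = (X - C X) * (C W * PowerSeries.map C W) -
      C X * X * (C W * PowerSeries.map C (mapDer (δ 1) W) -
        C (mapDer (δ 1) W) * PowerSeries.map C W) := by
    linear_combination C W * hfay - C X * X * PowerSeries.map C W * hder'
  have hswap := congrArg swap hanti
  have hXX : swap (C (X : PowerSeries R)) = X := by rw [swap_C, map_X]
  simp only [map_mul, map_sub, swap_X, swap_C, swap_map_C, map_X] at hswap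
  rw [← sub_eq_zero]
  refine eq_zero_of_X_sub_C_X_mul _ ?_
  linear_combination hanti + hswap

/-- Every unipotent series has a logarithmic derivative with respect to the flow. -/
theorem exists_flow_eq (hW0 : coeff 0 W = 1) :
    ∃ b : PowerSeries R, coeff 0 b = 0 ∧ flow δ W = -(b * W) := by
  obtain ⟨V, hV⟩ : ∃ V, W * V = 1 :=
    isUnit_iff_exists_inv.1 (isUnit_iff_constantCoeff.2 (by
      rw [← coeff_zero_eq_constantCoeff_apply, hW0]; exact isUnit_one))
  refine ⟨-(flow δ W * V), ?_, by rw [neg_mul, neg_neg, mul_assoc, mul_comm V, hV, mul_one]⟩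
  rw [map_neg, coeff_zero_mul, coeff_flow]
  simp [natDer_zero]

/-- The one-form `d log τ` of a series that satisfies the Fay relations is closed. -/
theorem SatisfiesFay.closed (hG : IsShift δ G) (hδ : ∀ j k f, δ j (δ k f) = δ k (δ j f))
    (hW0 : coeff 0 W = 1) (hW : SatisfiesFay G W) {b : PowerSeries R}
    (hb : flow δ W = -(b * W)) (j k : ℕ+) :
    δ j (coeff (k : ℕ) b) = δ k (coeff (j : ℕ) b) := by
  have hunit : IsUnit W := isUnit_iff_constantCoeff.2 (by
    rw [← coeff_zero_eq_constantCoeff_apply, hW0]; exact isUnit_one)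
  -- The derivations act on coefficients in the inner variable X, so `flow ε` is the flow in the
  -- outer variable Y.
  let ε : ℕ+ → Derivation ℝ (PowerSeries R) (PowerSeries R) := fun k => mapDer (δ k)
  set P := PowerSeries.map hG.toRingHom W with hP
  have hsymm := hW.symm hG hW0
  have hPunit : IsUnit P := isUnit_iff_constantCoeff.2 (by
    rw [← coeff_zero_eq_constantCoeff_apply, hP, coeff_map, hW0, map_one]; exact isUnit_one)
  have hflowP : flow ε P = -(PowerSeries.map hG.toRingHom b * P) := by
    rw [hP, flow_map δ ε hG.toRingHom (fun k f => hG.map_der hδ k f), hb, map_neg, map_mul]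
  have hflowC : flow ε (PowerSeries.map C W) = -(PowerSeries.map C b * PowerSeries.map C W) := by
    rw [flow_map δ ε C (fun k f => (mapDer_C (δ k) f).symm), hb, map_neg, map_mul]
  -- `swap P` is G(Y)W(X), a Miwa shift in Y.
  have hflowQ : flow ε (swap P) = 0 := by
    ext n m
    have h := congrArg (coeff n) (hG.flow_eq_zero (coeff m W))
    rw [coeff_flow] at h ⊢
    rw [map_zero] at h
    rw [map_zero (coeff n), map_zero, map_add, map_sum, ← h]
    congr 1
    · rw [← nsmul_eq_mul, map_nsmul, coeff_swap, hP, coeff_map, nsmul_eq_mul]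
      rfl
    · refine sum_congr rfl fun p _ => ?_
      rw [natDer_mapDer, coeff_mapDer, coeff_swap, hP, coeff_map]
      rfl
  have hmain : flow ε (C W) =
      C W * (PowerSeries.map hG.toRingHom b - PowerSeries.map C b) := by
    have h := congrArg (flow ε) hsymm
    rw [Derivation.leibniz, Derivation.leibniz, hflowP, hflowC, hflowQ] at h
    simp only [smul_eq_mul] at h
    refine hPunit.mul_right_cancel ?_
    linear_combination h + PowerSeries.map C b * hsymm
  have hcoef : ∀ k : ℕ+, mapDer (δ k) W = W * (G (coeff (k : ℕ) b) - C (coeff (k : ℕ) b)) :=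
    fun k => by
      have h := congrArg (coeff (k : ℕ)) hmain
      rw [flow_C, coeff_mk, natDer_pnat, coeff_C_mul, map_sub, coeff_map, coeff_map] at h
      exact h
  -- Now the flow in X is applied to δ_k W = W (G b_k - b_k). The terms with b (G b_k - b_k) cancel
  -- and W is divided out, leaving ∑_j X^j δ_j b_k = δ_k b.
  have h1 := flow_mapDer δ hδ k W
  rw [hb, map_neg, Derivation.leibniz, hcoef, Derivation.leibniz, map_sub, hG.flow_eq_zero, hb] at h1
  simp only [smul_eq_mul] at h1
  have h2 : flow δ (C (coeff (k : ℕ) b)) = mapDer (δ k) b := by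
    refine hunit.mul_left_cancel ?_
    linear_combination -h1
  rw [flow_C] at h2
  have h3 := congrArg (coeff (j : ℕ)) h2
  rwa [coeff_mk, natDer_pnat, coeff_mapDer] at h3

/-- The series of a `τ`-function is determined by the logarithmic derivatives of `τ`. -/
theorem eq_shift_mul_inv (hG : IsShift δ G) (hW0 : coeff 0 W = 1) {b : PowerSeries R}
    (hb0 : coeff 0 b = 0) (hb : flow δ W = -(b * W)) (τ : Rˣ)
    (hτ : ∀ k : ℕ+, δ k (τ : R) = coeff (k : ℕ) b * τ) :
    W = G τ * C ((τ⁻¹ : Rˣ) : R) := by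
  have hinv : ∀ k : ℕ+, δ k ((τ⁻¹ : Rˣ) : R) = -(coeff (k : ℕ) b * ((τ⁻¹ : Rˣ) : R)) := fun k => by
    have h := congrArg (δ k) τ.mul_inv
    rw [Derivation.leibniz, Derivation.map_one_eq_zero, hτ, smul_eq_mul, smul_eq_mul] at h
    refine τ.isUnit.mul_left_cancel ?_
    linear_combination h
  have hflow : flow δ (C ((τ⁻¹ : Rˣ) : R)) = -(b * C ((τ⁻¹ : Rˣ) : R)) := by
    rw [flow_C]
    ext n
    rw [coeff_mk, map_neg, coeff_mul_C]
    cases n with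
    | zero => rw [hb0]; simp [natDer_zero]
    | succ n => exact hinv n.succPNat
  refine eq_of_flow_eq_mul δ (c := -b) (by rw [map_neg, hb0, neg_zero]) ?_
    (by rw [hb, neg_mul]) ?_
  · rw [coeff_zero_mul, hG.coeff_zero, coeff_zero_C, hW0, τ.mul_inv]
  · rw [Derivation.leibniz, hG.flow_eq_zero, hflow, smul_eq_mul, smul_zero, add_zero]
    ring

end MiwaShift

/-- A sequence can be constructed by solving for one term after the other. -/
theorem exists_seq_of_step {α : Type*} [Nonempty α] (P : ℕ → (ℕ → α) → Prop)
    (hP : ∀ n w w', (∀ m ≤ n, w m = w' m) → P n w → P n w')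
    (hstep : ∀ n w, (∀ m < n, P m w) → ∃ x, P n (Function.update w n x)) :
    ∃ w, ∀ n, P n w := by
  choose x hx using hstep
  let step : ∀ n, {w : ℕ → α // ∀ m < n, P m w} → {w : ℕ → α // ∀ m < n + 1, P m w} :=
    fun n w => ⟨Function.update w.1 n (x n w.1 w.2), fun m hm => by
      rcases Nat.lt_succ_iff_lt_or_eq.1 hm with h | rfl
      · refine hP m w.1 _ (fun i hi => ?_) (w.2 m h)
        rw [Function.update_of_ne (by omega)]
      · exact hx m w.1 w.2⟩
  let seq : ∀ n, {w : ℕ → α // ∀ m < n, P m w} :=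
    fun n => Nat.rec ⟨fun _ => Classical.arbitrary α, fun m hm => absurd hm (Nat.not_lt_zero m)⟩ step n
  have hseq : ∀ n k m, m < n → (seq (n + k)).1 m = (seq n).1 m := fun n k => by
    induction k with
    | zero => exact fun _ _ => rfl
    | succ k ih =>
      intro m hm
      rw [← ih m hm]
      exact Function.update_of_ne (show m ≠ n + k by omega) _ _
  -- The diagonal: the term n is final from stage n + 1 on, and `P n` sees no later term.
  refine ⟨fun n => (seq (n + 1)).1 n, fun n => ?_⟩
  refine hP n (seq (n + 1)).1 _ (fun m hm => ?_) ((seq (n + 1)).2 n n.lt_succ_self)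
  obtain ⟨k, rfl⟩ := Nat.exists_eq_add_of_le hm
  rw [show m + k + 1 = m + 1 + k by ring]
  exact hseq (m + 1) k m m.lt_succ_self

/-! ### Unipotent operators, parts of operators and derivations acting on them. -/

namespace PsiDO

section Unipotent

variable {R : Type*} [CommRing R]

/-- `Φ = 1 + w₁ ∂⁻¹ + w₂ ∂⁻² + ⋯`. -/
def IsUnipotent (Φ : PsiDO R) : Prop := OrderLE 0 Φ ∧ Φ.coeff 0 = 1

/-- The operator `∑_n w_n ∂^{-n}`. -/
def ofSeq (w : ℕ → R) : PsiDO R where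
  coeff i := if i ≤ 0 then w (-i).toNat else 0
  bounded := ⟨0, fun _ hi => if_neg (not_le.2 hi)⟩

theorem coeff_ofSeq_neg (w : ℕ → R) (n : ℕ) : (ofSeq w).coeff (-n) = w n := by
  change (if (-n : ℤ) ≤ 0 then w (- -(n : ℤ)).toNat else 0) = w n
  rw [if_pos (by omega), neg_neg, Int.toNat_natCast]

theorem orderLE_ofSeq (w : ℕ → R) : OrderLE 0 (ofSeq w) := fun _ hi => if_neg (not_le.2 hi)

theorem isUnipotent_ofSeq {w : ℕ → R} (hw : w 0 = 1) : IsUnipotent (ofSeq w) :=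
  ⟨orderLE_ofSeq w, by rw [← hw, ← coeff_ofSeq_neg w 0, Nat.cast_zero, neg_zero]⟩

theorem ofSeq_ext {P Q : PsiDO R} (hP : OrderLE 0 P) (hQ : OrderLE 0 Q)
    (h : ∀ n : ℕ, P.coeff (-n) = Q.coeff (-n)) : P = Q := PsiDO.ext (funext fun i => by
  rcases lt_or_ge 0 i with hi | hi
  · rw [hP i hi, hQ i hi]
  · obtain ⟨n, hn⟩ := Int.exists_eq_neg_ofNat hi
    rw [hn, h])

theorem orderLE_ofSeq_sub {w w' : ℕ → R} {n : ℕ} (h : ∀ m < n, w m = w' m) :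
    OrderLE (-n) (ofSeq w - ofSeq w') := fun i hi => by
  rw [coeff_sub]
  rcases lt_or_ge 0 i with hi' | hi'
  · rw [orderLE_ofSeq w i hi', orderLE_ofSeq w' i hi', sub_zero]
  · obtain ⟨m, rfl⟩ := Int.exists_eq_neg_ofNat hi'
    rw [coeff_ofSeq_neg, coeff_ofSeq_neg, h m (by omega), sub_self]

variable [Differential R]

/-- K lowers the order, so only terms of `w` before the n-th enter. This makes the systems for
inverses and wave operators triangular. -/
theorem coeff_mul_ofSeq_congr {K : PsiDO R} (hK : OrderLE (-1) K) {w w' : ℕ → R} {n : ℕ}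
    (h : ∀ m < n, w m = w' m) : (K * ofSeq w).coeff (-n) = (K * ofSeq w').coeff (-n) := by
  rw [← sub_eq_zero, ← coeff_sub, ← mul_sub]
  exact (hK.mul (orderLE_ofSeq_sub h)) _ (by omega)

theorem coeff_mul_ofSeq_update {K : PsiDO R} (hK : OrderLE (-1) K) (w : ℕ → R) (n : ℕ) (x : R) :
    (K * ofSeq (Function.update w n x)).coeff (-n) = (K * ofSeq w).coeff (-n) :=
  coeff_mul_ofSeq_congr hK fun _ hm => Function.update_of_ne (ne_of_lt hm) _ _

theorem IsUnipotent.mul {P Q : PsiDO R} (hP : IsUnipotent P) (hQ : IsUnipotent Q) :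
    IsUnipotent (P * Q) :=
  ⟨by simpa using hP.1.mul hQ.1, by
    have := coeff_mul_of_orderLE hP.1 hQ.1
    rwa [hP.2, hQ.2, mul_one, add_zero] at this⟩

/-- The equation Ψ = 1 - (Φ - 1)Ψ determines the coefficients of Ψ recursively. -/
theorem IsUnipotent.exists_right_inv {Φ : PsiDO R} (hΦ : IsUnipotent Φ) :
    ∃ Ψ, IsUnipotent Ψ ∧ Φ * Ψ = 1 := by
  have hK : OrderLE (-1) (Φ - 1) := fun i hi => by
    rw [coeff_sub, coeff_one]
    split_ifs with h
    · rw [h, hΦ.2, sub_self]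
    · rw [hΦ.1 i (by omega), sub_zero]
  obtain ⟨w, hw⟩ := exists_seq_of_step
    (fun n (w : ℕ → R) => w n = (1 : PsiDO R).coeff (-n) - ((Φ - 1) * ofSeq w).coeff (-n))
    (fun n w w' h hw => by
      rw [← h n le_rfl, hw, coeff_mul_ofSeq_congr hK fun m hm => h m hm.le])
    (fun n w _ => ⟨(1 : PsiDO R).coeff (-n) - ((Φ - 1) * ofSeq w).coeff (-n), by
      rw [Function.update_self, coeff_mul_ofSeq_update hK]⟩)
  have h0 : w 0 = 1 := by
    rw [hw 0, coeff_one, (hK.mul (orderLE_ofSeq w)) _ (by simp)]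
    simp
  refine ⟨ofSeq w, isUnipotent_ofSeq h0, ?_⟩
  refine ofSeq_ext (hΦ.mul (isUnipotent_ofSeq h0)).1 (orderLE_dPow 0) fun n => ?_
  have h : Φ * ofSeq w = ofSeq w + (Φ - 1) * ofSeq w := by noncomm_ring
  rw [h, coeff_add, coeff_ofSeq_neg, hw n]
  ring

/-- Unipotent operators are invertible. -/
theorem IsUnipotent.exists_inv {Φ : PsiDO R} (hΦ : IsUnipotent Φ) :
    ∃ Ψ, IsUnipotent Ψ ∧ Φ * Ψ = 1 ∧ Ψ * Φ = 1 := by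
  obtain ⟨Ψ, hΨ, h⟩ := hΦ.exists_right_inv
  obtain ⟨Φ', _, h'⟩ := hΨ.exists_right_inv
  refine ⟨Ψ, hΨ, h, ?_⟩
  rwa [left_inv_eq_right_inv h h']

theorem IsUnipotent.orderLE_of_mul {Φ B : PsiDO R} (hΦ : IsUnipotent Φ) {n : ℤ}
    (h : OrderLE n (B * Φ)) : OrderLE n B := by
  obtain ⟨Ψ, hΨ, h1, _⟩ := hΦ.exists_inv
  have := h.mul hΨ.1
  rwa [mul_assoc, h1, mul_one, add_zero] at this

end Unipotent

section Parts

variable {R : Type*} [CommRing R]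

theorem IsDifferential.add {P Q : PsiDO R} (hP : IsDifferential P) (hQ : IsDifferential Q) :
    IsDifferential (P + Q) := fun i hi => by rw [coeff_add, hP i hi, hQ i hi, add_zero]

theorem IsDifferential.neg {P : PsiDO R} (hP : IsDifferential P) :
    IsDifferential (-P) := fun i hi => by rw [coeff_neg, hP i hi, neg_zero]

theorem IsDifferential.sum {ι : Type*} {s : Finset ι} {f : ι → PsiDO R}
    (h : ∀ j ∈ s, IsDifferential (f j)) : IsDifferential (∑ j ∈ s, f j) := fun i hi => by
  rw [coeff_sum]
  exact Finset.sum_eq_zero fun j hj => h j hj i hi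

theorem neg_part_add (P Q : PsiDO R) : (P + Q).neg = P.neg + Q.neg := by
  ext i
  change P.coeff i + Q.coeff i - (P + Q).pos.coeff i =
    P.coeff i - P.pos.coeff i + (Q.coeff i - Q.pos.coeff i)
  rw [coeff_pos_part, coeff_pos_part, coeff_pos_part]
  split_ifs <;> simp

theorem IsDifferential.neg_part {P : PsiDO R} (h : IsDifferential P) : P.neg = 0 := by
  ext i
  change P.coeff i - P.pos.coeff i = 0
  rw [coeff_pos_part]
  split_ifs with hi
  · simp
  · rw [h i (by omega), sub_zero]

theorem OrderLE.neg_part {P : PsiDO R} (h : OrderLE (-1) P) : P.neg = P := by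
  ext i
  change P.coeff i - P.pos.coeff i = P.coeff i
  rw [coeff_pos_part]
  split_ifs with hi
  · rw [h i (by omega), sub_zero]
  · simp

end Parts

section MapCoeff

variable {R : Type*} [CommRing R] [Algebra ℝ R]

theorem coeff_mapCoeff (d : Derivation ℝ R R) (P : PsiDO R) (i : ℤ) :
    (P.mapCoeff d).coeff i = d (P.coeff i) := rfl

theorem mapCoeff_dPow (d : Derivation ℝ R R) (j : ℤ) : (dPow j : PsiDO R).mapCoeff d = 0 := by
  ext i
  rw [coeff_mapCoeff, coeff_dPow]
  split_ifs <;> simp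

theorem mapCoeff_one (d : Derivation ℝ R R) : (1 : PsiDO R).mapCoeff d = 0 := mapCoeff_dPow d 0

theorem mapCoeff_neg_part (d : Derivation ℝ R R) (P : PsiDO R) :
    P.neg.mapCoeff d = (P.mapCoeff d).neg := by
  ext i
  change d (P.coeff i - P.pos.coeff i) = d (P.coeff i) - (P.mapCoeff d).pos.coeff i
  rw [coeff_pos_part, coeff_pos_part, map_sub]
  split_ifs <;> simp [coeff_mapCoeff]

theorem OrderLE.mapCoeff {n : ℤ} {P : PsiDO R} (hP : OrderLE n P) (d : Derivation ℝ R R) :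
    OrderLE n (P.mapCoeff d) := fun i hi => by rw [coeff_mapCoeff, hP i hi, map_zero]

theorem IsDifferential.mapCoeff {P : PsiDO R} (hP : IsDifferential P) (d : Derivation ℝ R R) :
    IsDifferential (P.mapCoeff d) := fun i hi => by rw [coeff_mapCoeff, hP i hi, map_zero]

variable [Differential R]

theorem mapCoeff_mul {d : Derivation ℝ R R}
    (hd : ∀ f, d ((Differential.deriv : Derivation ℤ R R) f) =
      (Differential.deriv : Derivation ℤ R R) (d f)) (P Q : PsiDO R) :
    (P * Q).mapCoeff d = P.mapCoeff d * Q + P * Q.mapCoeff d := by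
  have hd' : ∀ k f, d ((Differential.deriv : Derivation ℤ R R)^[k] f) =
      (Differential.deriv : Derivation ℤ R R)^[k] (d f) := fun k => by
    induction k with
    | zero => exact fun _ => rfl
    | succ k ih => intro f; rw [Function.iterate_succ_apply, Function.iterate_succ_apply, ih, hd]
  ext n
  rw [coeff_mapCoeff, coeff_add, coeff_mul, coeff_mul, coeff_mul, ← finsum_add_distrib
    (finite_support_coeff_mul _ _ n) (finite_support_coeff_mul _ _ n)]
  refine (d.toLinearMap.toAddMonoidHom.map_finsum (finite_support_coeff_mul P Q n)).trans
    (finsum_congr fun p => ?_)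
  change d _ = _
  rw [map_zsmul, Derivation.leibniz, hd', ← smul_add, coeff_mapCoeff, coeff_mapCoeff, smul_eq_mul,
    smul_eq_mul]
  congr 1
  ring

theorem dPow_one_mul_eq {d : Derivation ℝ R R}
    (hd : ∀ f, (Differential.deriv : Derivation ℤ R R) f = d f) (P : PsiDO R) :
    dPow 1 * P = P.mapCoeff d + P * dPow 1 := by
  ext n
  rw [coeff_dPow_one_mul, coeff_add, coeff_mapCoeff, coeff_mul_dPow, hd, add_comm]

end MapCoeff

end PsiDO

/-! ### Zero curvature and the linear system for the wave operator. -/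

namespace PsiDO

section KP

variable {R : Type*} [CommRing R] [Algebra ℝ R] [Differential R] {δ : ℕ+ → Derivation ℝ R R}

variable {L : PsiDO R}

theorem mapCoeff_pow_of_commutator {d : Derivation ℝ R R}
    (hd : ∀ f, d ((Differential.deriv : Derivation ℤ R R) f) =
      (Differential.deriv : Derivation ℤ R R) (d f)) {B : PsiDO R}
    (h : L.mapCoeff d = B * L - L * B) (r : ℕ) :
    (L ^ r).mapCoeff d = B * L ^ r - L ^ r * B := by
  induction r with
  | zero => rw [pow_zero, mapCoeff_one]; noncomm_ring
  | succ r ih => rw [pow_succ, mapCoeff_mul hd, ih, h]; noncomm_ring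

/-- The zero curvature equations for the integral parts of the powers of `L`. -/
theorem zero_curvature
    (hd : ∀ k f, δ k ((Differential.deriv : Derivation ℤ R R) f) =
      (Differential.deriv : Derivation ℤ R R) (δ k f))
    (hKP : ∀ r : ℕ+, L.mapCoeff (δ r) = (L ^ (r : ℕ)).pos * L - L * (L ^ (r : ℕ)).pos)
    (r s : ℕ+) :
    (L ^ (r : ℕ)).neg.mapCoeff (δ s) - (L ^ (s : ℕ)).neg.mapCoeff (δ r) =
      (L ^ (r : ℕ)).neg * (L ^ (s : ℕ)).neg - (L ^ (s : ℕ)).neg * (L ^ (r : ℕ)).neg := by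
  have h1 := mapCoeff_pow_of_commutator (hd s) (hKP s) r
  have h2 := mapCoeff_pow_of_commutator (hd r) (hKP r) s
  have hc : L ^ (r : ℕ) * L ^ (s : ℕ) = L ^ (s : ℕ) * L ^ (r : ℕ) := by
    rw [← pow_add, ← pow_add, add_comm]
  rw [mapCoeff_neg_part, mapCoeff_neg_part, h1, h2]
  generalize L ^ (r : ℕ) = P at *
  generalize L ^ (s : ℕ) = Q at *
  have hP := P.pos_add_neg_part
  have hQ := Q.pos_add_neg_part
  -- As P and Q commute, [Q₊, P] - [P₊, Q] = -[P₊, Q₊] + [P₋, Q₋]; the first commutator is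
  -- differential, so only the second survives in the integral part.
  have e : Q.pos * P - P * Q.pos =
      P.pos * Q - Q * P.pos +
        ((P.pos * Q.pos - Q.pos * P.pos) * (-1) + (P.neg * Q.neg - Q.neg * P.neg)) := by
    have h : ∀ a b c d : PsiDO R, (a + b) * (c + d) = (c + d) * (a + b) →
        c * (a + b) - (a + b) * c =
          a * (c + d) - (c + d) * a + ((a * c - c * a) * (-1) + (b * d - d * b)) := by
      intro a b c d h
      rw [← sub_eq_zero] at h ⊢
      rw [← neg_eq_zero, ← h]
      noncomm_ring
    have := h P.pos P.neg Q.pos Q.neg (by rw [hP, hQ, hc])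
    rwa [hP, hQ] at this
  have hdiff : IsDifferential ((P.pos * Q.pos - Q.pos * P.pos) * (-1)) := by
    rw [mul_neg_one, sub_eq_add_neg]
    exact (((isDifferential_pos P).mul (isDifferential_pos Q)).add
      ((isDifferential_pos Q).mul (isDifferential_pos P)).neg).neg
  have hint : OrderLE (-1) (P.neg * Q.neg - Q.neg * P.neg) :=
    (((orderLE_neg_part P).mul (orderLE_neg_part Q)).mono (by omega)).sub
      (((orderLE_neg_part Q).mul (orderLE_neg_part P)).mono (by omega))
  rw [e, neg_part_add, neg_part_add, hdiff.neg_part, hint.neg_part]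
  abel

/-- Existence of a solution of the linear system `δ_r Φ = -(L^r)₋ Φ`. -/
theorem exists_evolution
    (hd : ∀ k f, δ k ((Differential.deriv : Derivation ℤ R R) f) =
      (Differential.deriv : Derivation ℤ R R) (δ k f))
    (hpoinc : ∀ b : ℕ+ → R, (∀ j k, δ j (b k) = δ k (b j)) → ∃ f, ∀ k, δ k f = b k)
    {N : ℕ+ → PsiDO R} (hN : ∀ r, OrderLE (-1) (N r))
    (hcurv : ∀ r s, (N r).mapCoeff (δ s) - (N s).mapCoeff (δ r) = N r * N s - N s * N r) :
    ∃ Φ, IsUnipotent Φ ∧ ∀ r, Φ.mapCoeff (δ r) = -(N r * Φ) := by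
  obtain ⟨w, hw⟩ := exists_seq_of_step
    (fun n (w : ℕ → R) => (n = 0 → w n = 1) ∧ ∀ r, δ r (w n) = -(N r * ofSeq w).coeff (-n))
    (fun n w w' h hw => by
      refine ⟨fun hn => by rw [← h n le_rfl, hw.1 hn], fun r => ?_⟩
      rw [← h n le_rfl, hw.2, coeff_mul_ofSeq_congr (hN r) fun m hm => h m hm.le])
    (fun n w ih => by
      simp only [Function.update_self, coeff_mul_ofSeq_update (hN _)]
      rcases Nat.eq_zero_or_pos n with rfl | hn
      · refine ⟨1, fun _ => rfl, fun r => ?_⟩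
        rw [Derivation.map_one_eq_zero, ((hN r).mul (orderLE_ofSeq w)) _ (by simp), neg_zero]
      obtain ⟨x, hx⟩ := hpoinc (fun r => -(N r * ofSeq w).coeff (-n)) (fun s r => by
        -- The equations already hold for the coefficients before the n-th. The error that is left
        -- has order at most -n, and N r pushes it below the coefficient considered.
        have herr : ∀ s, OrderLE (-n) ((ofSeq w).mapCoeff (δ s) + N s * ofSeq w) := by
          intro s i hi
          rcases lt_or_ge 0 i with hi' | hi'
          · rw [coeff_add, coeff_mapCoeff, orderLE_ofSeq w i hi', map_zero,
              ((hN s).mul (orderLE_ofSeq w)) i (by omega), add_zero]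
          · obtain ⟨m, rfl⟩ := Int.exists_eq_neg_ofNat hi'
            rw [coeff_add, coeff_mapCoeff, coeff_ofSeq_neg, (ih m (by omega)).2, neg_add_cancel]
        have hexp : ∀ r s, δ s ((N r * ofSeq w).coeff (-n)) =
            (((N r).mapCoeff (δ s) - N r * N s) * ofSeq w).coeff (-n) := by
          intro r s
          have e : (N r * ofSeq w).mapCoeff (δ s) =
              ((N r).mapCoeff (δ s) - N r * N s) * ofSeq w +
                N r * ((ofSeq w).mapCoeff (δ s) + N s * ofSeq w) := by
            rw [mapCoeff_mul (hd s)]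
            noncomm_ring
          rw [← coeff_mapCoeff, e, coeff_add, ((hN r).mul (herr s)) _ (by omega), add_zero]
        have hsame : (N r).mapCoeff (δ s) - N r * N s = (N s).mapCoeff (δ r) - N s * N r := by
          have := hcurv r s
          rw [sub_eq_sub_iff_add_eq_add] at this ⊢
          rw [this]
          abel
        rw [map_neg, map_neg, hexp, hexp, hsame])
      exact ⟨x, fun h => absurd h hn.ne', hx⟩)
  have h0 : w 0 = 1 := (hw 0).1 rfl
  refine ⟨ofSeq w, isUnipotent_ofSeq h0, fun r => ?_⟩
  refine ofSeq_ext ((orderLE_ofSeq w).mapCoeff _)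
    ((((hN r).mul (orderLE_ofSeq w)).mono (by simp)).neg) fun n => ?_
  rw [coeff_mapCoeff, coeff_ofSeq_neg, (hw n).2, coeff_neg]

end KP

/-! ### The Fay relations of a wave operator. -/

section Fay

open PowerSeries Finset MiwaShift

variable {R : Type*} [CommRing R] [Algebra ℝ R] {δ : ℕ+ → Derivation ℝ R R}
  {G : R → PowerSeries R} {Φ : PsiDO R}

/-- The coefficient of `X^n` in `(G Φ) (1 - X ∂)`. -/
def shiftCoeff (hG : IsShift δ G) (Φ : PsiDO R) (n : ℕ) : PsiDO R where
  coeff i := PowerSeries.coeff n (G (Φ.coeff i) - PowerSeries.X * G (Φ.coeff (i - 1)))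
  bounded := by
    obtain ⟨N, hN⟩ := Φ.bounded
    refine ⟨N + 1, fun i hi => ?_⟩
    rw [hN i (by omega), hN (i - 1) (by omega)]
    simp [show G 0 = 0 from hG.toRingHom.map_zero]

theorem coeff_shiftCoeff (hG : IsShift δ G) (Φ : PsiDO R) (n : ℕ) (i : ℤ) :
    (shiftCoeff hG Φ n).coeff i =
      PowerSeries.coeff n (G (Φ.coeff i) - PowerSeries.X * G (Φ.coeff (i - 1))) := rfl

/-- Multiplication by the geometric series ∑ X^k ∂^k undoes the factor 1 - X∂. -/
theorem sum_shiftCoeff (hG : IsShift δ G) (Φ : PsiDO R) (n : ℕ) (i : ℤ) :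
    ∑ p ∈ antidiagonal n, (shiftCoeff hG Φ p.2).coeff (i - p.1) =
      PowerSeries.coeff n (G (Φ.coeff i)) := by
  induction n generalizing i with
  | zero => simp [coeff_shiftCoeff]
  | succ n ih =>
    rw [Finset.Nat.sum_antidiagonal_succ]
    have h : ∀ p ∈ antidiagonal n, (shiftCoeff hG Φ p.2).coeff (i - (p.1 + 1 : ℕ)) =
        (shiftCoeff hG Φ p.2).coeff (i - 1 - p.1) := fun p _ => by
      congr 1
      push_cast
      ring
    rw [sum_congr rfl h, ih, coeff_shiftCoeff]
    simp [coeff_succ_X_mul]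

variable [Differential R]

/-- Put S = (GΦ)(1 - X∂). The flow kills GΦ and multiplies 1 - X∂ by -∑_{k ≥ 1} X^k ∂^k, so the flow
of S is -S ∑_{k ≥ 1} X^k ∂^k; this is its coefficient in degree n + 1. -/
theorem shiftCoeff_succ (hG : IsShift δ G) (Φ : PsiDO R) (n : ℕ) :
    (n + 1) • shiftCoeff hG Φ (n + 1) =
      -∑ p ∈ antidiagonal n, ((shiftCoeff hG Φ p.2).mapCoeff (δ p.1.succPNat) +
        shiftCoeff hG Φ p.2 * dPow (p.1 + 1 : ℕ)) := by
  ext i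
  have h1 : flow δ (G (Φ.coeff i) - PowerSeries.X * G (Φ.coeff (i - 1))) =
      -(PowerSeries.X * G (Φ.coeff (i - 1))) := by
    have hX : flow δ (PowerSeries.X : PowerSeries R) = PowerSeries.X := by
      ext n
      rw [coeff_flow, coeff_X, sum_eq_zero, add_zero]
      · split_ifs with h <;> simp [h]
      · intro p _
        rw [coeff_X]
        split_ifs <;> simp
    rw [map_sub, Derivation.leibniz, hG.flow_eq_zero, hG.flow_eq_zero, hX]
    simp only [smul_eq_mul]
    ring
  have h2 := congrArg (PowerSeries.coeff (n + 1)) h1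
  rw [coeff_flow, map_neg, coeff_succ_X_mul, Finset.Nat.sum_antidiagonal_succ, natDer_zero,
    ← sum_shiftCoeff hG] at h2
  rw [coeff_nsmul, coeff_shiftCoeff, nsmul_eq_mul, coeff_neg, coeff_sum]
  simp only [coeff_add, coeff_mapCoeff, coeff_mul_dPow, sum_add_distrib]
  have h3 : ∀ p ∈ antidiagonal n, (shiftCoeff hG Φ p.2).coeff (i - (p.1 + 1 : ℕ)) =
      (shiftCoeff hG Φ p.2).coeff (i - 1 - p.1) := fun p _ => by
    congr 1
    push_cast
    ring
  rw [sum_congr rfl h3]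
  simp only [Derivation.coe_zero, Pi.zero_apply, zero_add] at h2
  have h4 : ∀ p ∈ antidiagonal n, natDer δ (p.1 + 1) (PowerSeries.coeff p.2
      (G (Φ.coeff i) - PowerSeries.X * G (Φ.coeff (i - 1)))) =
      δ p.1.succPNat ((shiftCoeff hG Φ p.2).coeff i) := fun p _ => rfl
  rw [sum_congr rfl h4] at h2
  linear_combination h2

/-- The Miwa shift of a wave operator is obtained by applying differential operators. -/
theorem exists_shiftCoeff_eq (hG : IsShift δ G)
    (hd : ∀ k f, δ k ((Differential.deriv : Derivation ℤ R R) f) =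
      (Differential.deriv : Derivation ℤ R R) (δ k f))
    {B : ℕ+ → PsiDO R} (hB : ∀ r, IsDifferential (B r))
    (hΦ : ∀ r : ℕ+, Φ.mapCoeff (δ r) + Φ * dPow (r : ℕ) = B r * Φ) (n : ℕ) :
    ∃ E, IsDifferential E ∧ shiftCoeff hG Φ n = E * Φ := by
  induction n using Nat.strong_induction_on with
  | _ n ih =>
    cases n with
    | zero =>
      refine ⟨1, isDifferential_one, ?_⟩
      ext i
      rw [one_mul, coeff_shiftCoeff, map_sub, hG.coeff_zero, coeff_zero_X_mul, sub_zero]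
    | succ n =>
      choose! E hE hE' using ih
      -- The recursion sends EΦ to δ_r(EΦ) + EΦ∂^r = (δ_r E + E B_r) Φ, with a differential operator
      -- in the bracket.
      let S := -∑ p ∈ antidiagonal n, ((E p.2).mapCoeff (δ p.1.succPNat) + E p.2 * B p.1.succPNat)
      have hle : ∀ p ∈ antidiagonal n, p.2 < n + 1 := fun p hp => by
        have := HasAntidiagonal.mem_antidiagonal.1 hp
        omega
      have hS : IsDifferential S := (IsDifferential.sum fun p hp =>
        ((hE _ (hle p hp)).mapCoeff _).add ((hE _ (hle p hp)).mul (hB _))).neg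
      have h1 : (n + 1) • shiftCoeff hG Φ (n + 1) = S * Φ := by
        rw [shiftCoeff_succ, neg_mul, sum_mul]
        congr 1
        refine sum_congr rfl fun p hp => ?_
        rw [hE' _ (hle p hp), mapCoeff_mul (hd _), add_mul, mul_assoc _ (B _), ← hΦ, mul_add,
          add_assoc, mul_assoc]
        rfl
      let a : R := algebraMap ℝ R ((n + 1 : ℕ) : ℝ)⁻¹
      refine ⟨mono a 0 * S, fun i hi => by rw [coeff_mono_zero_mul, hS i hi, mul_zero], ?_⟩
      rw [mul_assoc, ← h1]
      ext i
      rw [coeff_mono_zero_mul, coeff_nsmul, nsmul_eq_mul, ← mul_assoc]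
      have ha : a * ((n + 1 : ℕ) : R) = 1 := by
        rw [← map_natCast (algebraMap ℝ R), ← map_mul, inv_mul_cancel₀ (by positivity), map_one]
      rw [ha, one_mul]

/-- In degree n + 2 the ∂-coefficient of (GΦ)(1 - X∂) is a positive coefficient of G 1 = 1, hence
zero. So the differential operator E has order at most 0 and is multiplication by a function; ∂^0
identifies that function and ∂^{-m} gives the relation. -/
theorem satisfiesFay (hG : IsShift δ G)
    (hd : ∀ k f, δ k ((Differential.deriv : Derivation ℤ R R) f) =
      (Differential.deriv : Derivation ℤ R R) (δ k f))
    {B : ℕ+ → PsiDO R} (hB : ∀ r, IsDifferential (B r)) (hU : IsUnipotent Φ)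
    (hΦ : ∀ r : ℕ+, Φ.mapCoeff (δ r) + Φ * dPow (r : ℕ) = B r * Φ) :
    SatisfiesFay G (PowerSeries.mk fun i => Φ.coeff (-(i : ℤ))) := by
  intro n m
  obtain ⟨E, hE, hE'⟩ := exists_shiftCoeff_eq hG hd hB hΦ (n + 2)
  have hG0 : G 0 = 0 := hG.toRingHom.map_zero
  have hord : OrderLE 0 (shiftCoeff hG Φ (n + 2)) := fun i hi => by
    rw [coeff_shiftCoeff, hU.1 i hi, hG0, zero_sub, map_neg, coeff_succ_X_mul]
    rcases eq_or_lt_of_le (show 1 ≤ i by omega) with rfl | hi'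
    · rw [sub_self, hU.2, hG.map_one, PowerSeries.coeff_one, if_neg n.succ_ne_zero, neg_zero]
    · rw [hU.1 (i - 1) (by omega), hG0, map_zero, neg_zero]
  have hEord : OrderLE 0 E := hU.orderLE_of_mul (hE' ▸ hord)
  have hEmono : E = mono (E.coeff 0) 0 := by
    ext i
    rw [coeff_mono]
    split_ifs with h
    · rw [h]
    · rcases lt_or_gt_of_ne h with h | h
      · exact hE i h
      · exact hEord i h
  have key : ∀ i, (shiftCoeff hG Φ (n + 2)).coeff i = E.coeff 0 * Φ.coeff i := fun i => by
    rw [hE', hEmono, coeff_mono_zero_mul, coeff_mono, if_pos rfl]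
  have h0 := key 0
  rw [hU.2, mul_one, coeff_shiftCoeff, hU.2, hG.map_one, map_sub, PowerSeries.coeff_one,
    if_neg (by omega), coeff_succ_X_mul] at h0
  have hm := key (-m)
  rw [← h0, coeff_shiftCoeff, map_sub, coeff_succ_X_mul] at hm
  simp only [coeff_mk]
  rw [show (-((m + 1 : ℕ) : ℤ)) = -m - 1 by push_cast; ring, hm]
  norm_num

end Fay

end PsiDO

/-! ### Comparison of units through the ratio G(τ) τ⁻¹. -/

namespace MiwaShift

open PowerSeries Finset

section Ratio

variable {R : Type*} [CommRing R] [Algebra ℝ R] {δ : ℕ+ → Derivation ℝ R R}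
  {G : R → PowerSeries R}

/-- The series `G(z)[τ] τ⁻¹`, multiplicative in the unit `τ`. -/
def ratio (hG : IsShift δ G) : Rˣ →* PowerSeries R where
  toFun τ := G τ * C ((τ⁻¹ : Rˣ) : R)
  map_one' := by simp [hG.map_one]
  map_mul' σ τ := by
    rw [mul_inv, Units.val_mul, Units.val_mul, hG.map_mul, map_mul]
    ring

theorem ratio_apply (hG : IsShift δ G) (τ : Rˣ) :
    ratio hG τ = G τ * C ((τ⁻¹ : Rˣ) : R) := rfl

theorem ratio_mul_C (hG : IsShift δ G) (τ : Rˣ) : ratio hG τ * C (τ : R) = G τ := by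
  rw [ratio_apply, mul_assoc, ← map_mul, τ.inv_mul, map_one, mul_one]

theorem isUnit_ratio (hG : IsShift δ G) (τ : Rˣ) : IsUnit (ratio hG τ) :=
  (Group.isUnit τ).map (ratio hG)

theorem coeff_zero_ratio (hG : IsShift δ G) (τ : Rˣ) : coeff 0 (ratio hG τ) = 1 := by
  rw [ratio_apply, coeff_zero_mul, hG.coeff_zero, coeff_zero_C, τ.mul_inv]

theorem ratio_eq_one_iff (hG : IsShift δ G) (σ : Rˣ) :
    ratio hG σ = 1 ↔ ∀ k, δ k (σ : R) = 0 := by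
  have h := ratio_mul_C hG σ
  refine ⟨fun h1 k => ?_, fun h1 => ?_⟩
  · rw [h1, one_mul] at h
    have h2 := congrArg (coeff (k : ℕ)) (hG.flow_eq_zero σ)
    rwa [← h, flow_C, coeff_mk, natDer_pnat, map_zero] at h2
  · rw [ratio_apply, hG.map_const h1, ← map_mul, σ.mul_inv, map_one]

theorem ratio_eq_ratio_mul (hG : IsShift δ G) (τ' τ : Rˣ) :
    ratio hG τ' = ratio hG τ * ratio hG (τ' * τ⁻¹) := by
  rw [← map_mul, mul_comm τ, inv_mul_cancel_right]

theorem ratio_eq_ratio_iff (hG : IsShift δ G) (τ' τ : Rˣ) :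
    ratio hG τ = ratio hG τ' ↔ ∀ k, δ k ((τ' * τ⁻¹ : Rˣ) : R) = 0 := by
  rw [← ratio_eq_one_iff hG, ratio_eq_ratio_mul hG τ' τ]
  constructor
  · intro h
    exact (isUnit_ratio hG τ).mul_left_cancel (by rw [← h, mul_one])
  · intro h
    rw [h, mul_one]

/-- The c_k are the coefficients of the logarithmic derivative b of the ratio along the flow. They
are constant because the flow commutes with each δ_j, and since the flow kills G σ = ratio · σ, it
multiplies σ by b. -/
theorem der_eq_of_ratio (hG : IsShift δ G) (hδ : ∀ j k f, δ j (δ k f) = δ k (δ j f)) {σ : Rˣ}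
    (h : ∀ k, mapDer (δ k) (ratio hG σ) = 0) :
    ∃ c : ℕ+ → R, (∀ j k, δ j (c k) = 0) ∧ ∀ k, δ k (σ : R) = c k * σ := by
  obtain ⟨b, -, hb⟩ := exists_flow_eq (δ := δ) (coeff_zero_ratio hG σ)
  have hu := isUnit_ratio hG σ
  refine ⟨fun k => coeff (k : ℕ) b, fun j k => ?_, fun k => ?_⟩
  · have h1 := flow_mapDer δ hδ j (ratio hG σ)
    rw [h j, map_zero, hb, map_neg, Derivation.leibniz, h j, smul_zero, zero_add, smul_eq_mul,
      zero_eq_neg] at h1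
    have h2 := hu.mul_left_cancel (h1.trans (mul_zero _).symm)
    have h3 := congrArg (coeff (k : ℕ)) h2
    rwa [coeff_mapDer, map_zero] at h3
  · have h1 := hG.flow_eq_zero (σ : R)
    rw [← ratio_mul_C hG, Derivation.leibniz, hb] at h1
    simp only [smul_eq_mul] at h1
    have h2 : flow δ (C (σ : R)) = b * C (σ : R) := hu.mul_left_cancel (by linear_combination h1)
    have h3 := congrArg (coeff (k : ℕ)) h2
    rwa [flow_C, coeff_mk, natDer_pnat, coeff_mul_C] at h3

/-- With c_k constant, G(σ) and σ have the same logarithmic derivatives. -/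
theorem mapDer_ratio_eq_zero (hG : IsShift δ G) (hδ : ∀ j k f, δ j (δ k f) = δ k (δ j f)) {σ : Rˣ}
    {c : ℕ+ → R} (hc : ∀ j k, δ j (c k) = 0) (h : ∀ k, δ k (σ : R) = c k * σ) (k : ℕ+) :
    mapDer (δ k) (ratio hG σ) = 0 := by
  have h1 := congrArg (mapDer (δ k)) (ratio_mul_C hG σ)
  rw [← hG.map_der hδ, h, hG.map_mul, hG.map_const fun j => hc j k, Derivation.leibniz, mapDer_C, h,
    map_mul] at h1
  have h2 := ratio_mul_C hG σ
  simp only [smul_eq_mul] at h1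
  have hu : IsUnit (C (σ : R)) := σ.isUnit.map C
  refine hu.mul_left_cancel ?_
  linear_combination h1 - C (c k) * h2

/-- Every closed family is the family of logarithmic derivatives of a unit. -/
def HasLogIntegrals (δ : ℕ+ → Derivation ℝ R R) : Prop :=
  ∀ b : ℕ+ → R, (∀ j k, δ j (b k) = δ k (b j)) → ∃ τ : Rˣ, ∀ k, δ k (τ : R) = b k * τ

theorem SatisfiesFay.exists_eq_ratio (hG : IsShift δ G) (hδ : ∀ j k f, δ j (δ k f) = δ k (δ j f))
    (hexp : HasLogIntegrals δ) {W : PowerSeries R} (hW0 : coeff 0 W = 1) (hW : SatisfiesFay G W) :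
    ∃ τ, W = ratio hG τ := by
  obtain ⟨b, hb0, hb⟩ := exists_flow_eq (δ := δ) hW0
  obtain ⟨τ, hτ⟩ := hexp (fun k => coeff (k : ℕ) b) (hW.closed hG hδ hW0 hb)
  exact ⟨τ, eq_shift_mul_inv hG hW0 hb0 hb τ hτ⟩

end Ratio

/-! ### The exponential formula for the Miwa shift. -/

section Exponential

variable {S : Type*} [Ring S] (Γ : PowerSeries S)

theorem coeff_pow_eq_zero (h0 : coeff 0 Γ = 0) {n j : ℕ} (h : n < j) : coeff n (Γ ^ j) = 0 := by
  induction j generalizing n with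
  | zero => omega
  | succ j ih =>
    rw [pow_succ, coeff_mul]
    refine sum_eq_zero fun p hp => ?_
    have hp := HasAntidiagonal.mem_antidiagonal.1 hp
    rcases Nat.eq_zero_or_pos p.2 with h2 | h2
    · rw [h2, h0, mul_zero]
    · rw [ih (by omega), zero_mul]

/-- This is X (Γ^{j+1})' = (j + 1)(XΓ') Γ^j; over the noncommutative ring S it needs commuting
coefficients. -/
theorem natCast_mul_coeff_pow (hΓ : ∀ i j, Commute (coeff i Γ) (coeff j Γ)) (n j : ℕ) :
    n • coeff n (Γ ^ (j + 1)) =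
      (j + 1) • ∑ p ∈ antidiagonal n, (p.1 • coeff p.1 Γ) * coeff p.2 (Γ ^ j) := by
  let T : PowerSeries S := PowerSeries.mk fun k => k • coeff k Γ
  have hT : Commute T Γ := by
    ext n
    rw [coeff_mul, coeff_mul, ← Finset.Nat.sum_antidiagonal_swap]
    refine sum_congr rfl fun p _ => ?_
    simp only [T, coeff_mk, Prod.fst_swap, Prod.snd_swap]
    exact ((hΓ p.2 p.1).smul_left p.2).eq
  have hmul : ∀ (F H : PowerSeries S) (n : ℕ), n • coeff n (F * H) =
      ∑ p ∈ antidiagonal n, (p.1 • coeff p.1 F) * coeff p.2 H +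
        ∑ p ∈ antidiagonal n, coeff p.1 F * (p.2 • coeff p.2 H) := fun F H n => by
    rw [coeff_mul, smul_sum, ← sum_add_distrib]
    refine sum_congr rfl fun p hp => ?_
    rw [← HasAntidiagonal.mem_antidiagonal.1 hp, add_smul, smul_mul_assoc, mul_smul_comm]
  have main : ∀ j n, n • coeff n (Γ ^ (j + 1)) = (j + 1) • coeff n (T * Γ ^ j) := fun j => by
    induction j with
    | zero => intro n; simp [T]
    | succ j ih =>
      intro n
      rw [pow_succ, hmul]
      have h1 : ∑ p ∈ antidiagonal n, (p.1 • coeff p.1 (Γ ^ (j + 1))) * coeff p.2 Γ =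
          (j + 1) • coeff n (T * Γ ^ (j + 1)) := by
        rw [pow_succ, ← mul_assoc, coeff_mul, smul_sum]
        exact sum_congr rfl fun p _ => by rw [← pow_succ, ih, smul_mul_assoc]
      have h2 : ∑ p ∈ antidiagonal n, coeff p.1 (Γ ^ (j + 1)) * (p.2 • coeff p.2 Γ) =
          coeff n (T * Γ ^ (j + 1)) := by
        rw [(hT.pow_right (j + 1)).eq, coeff_mul]
        simp only [T, coeff_mk]
      rw [h1, h2, ← succ_nsmul]
  rw [main, coeff_mul]
  simp only [T, coeff_mk]

variable [Algebra ℝ S]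

/-- The coefficients of the exponential of a power series without constant term. -/
def expCoeff (n : ℕ) : S :=
  ∑ j ∈ range (n + 1), ((j.factorial : ℝ)⁻¹ • coeff n (Γ ^ j))

theorem expCoeff_eq_sum (h0 : coeff 0 Γ = 0) {n B : ℕ} (h : n < B) :
    expCoeff Γ n = ∑ j ∈ range B, ((j.factorial : ℝ)⁻¹ • coeff n (Γ ^ j)) := by
  refine sum_subset (fun j hj => ?_) fun j _ hj => ?_
  · simp only [mem_range] at hj ⊢; omega
  · rw [coeff_pow_eq_zero Γ h0 (by simpa using hj), smul_zero]

theorem natCast_mul_expCoeff (h0 : coeff 0 Γ = 0)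
    (hΓ : ∀ i j, Commute (coeff i Γ) (coeff j Γ)) (n : ℕ) :
    n • expCoeff Γ n = ∑ p ∈ antidiagonal n, (p.1 • coeff p.1 Γ) * expCoeff Γ p.2 := by
  have h1 : ∀ p ∈ antidiagonal n, (p.1 • coeff p.1 Γ) * expCoeff Γ p.2 =
      ∑ j ∈ range (n + 1), ((j.factorial : ℝ)⁻¹ •
        ((p.1 • coeff p.1 Γ) * coeff p.2 (Γ ^ j))) := fun p hp => by
    have := HasAntidiagonal.mem_antidiagonal.1 hp
    rw [expCoeff_eq_sum Γ h0 (show p.2 < n + 1 by omega), mul_sum]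
    exact sum_congr rfl fun j _ => mul_smul_comm _ _ _
  rw [sum_congr rfl h1, sum_comm, expCoeff_eq_sum Γ h0 (show n < n + 1 + 1 by omega),
    sum_range_succ', smul_add, smul_sum]
  have h2 : n • ((Nat.factorial 0 : ℝ)⁻¹ • coeff n (Γ ^ 0)) = 0 := by
    rw [pow_zero, PowerSeries.coeff_one]
    split_ifs with h <;> simp [h]
  rw [h2, add_zero]
  refine sum_congr rfl fun j _ => ?_
  rw [smul_comm, natCast_mul_coeff_pow Γ hΓ, ← smul_sum, ← Nat.cast_smul_eq_nsmul ℝ, smul_smul,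
    Nat.factorial_succ]
  congr 1
  have := Nat.factorial_ne_zero j
  push_cast
  field_simp

end Exponential

section Endomorphisms

variable {R : Type*} [CommRing R] [Algebra ℝ R] (δ : ℕ+ → Derivation ℝ R R)

/-- The generator `-∑_k (X^k / k) δ_k`. -/
def generator : PowerSeries (Module.End ℝ R) :=
  PowerSeries.mk fun k =>
    if h : 0 < k then -((k : ℝ)⁻¹ • (δ ⟨k, h⟩).toLinearMap) else 0

/-- The exponential of the generator, applied to an element. -/
def expShift (f : R) : PowerSeries R :=
  PowerSeries.mk fun n =>
    (∑ j ∈ Finset.range (n + 1),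
      ((j.factorial : ℝ)⁻¹ • PowerSeries.coeff n (generator δ ^ j))) f

theorem coeff_generator_zero : coeff 0 (generator δ) = 0 := by
  rw [generator, coeff_mk, dif_neg (by omega)]

theorem coeff_generator_succ (k : ℕ) :
    coeff (k + 1) (generator δ) = -(((k + 1 : ℕ) : ℝ)⁻¹ • (δ k.succPNat).toLinearMap) := by
  rw [generator, coeff_mk, dif_pos k.succ_pos]
  rfl

theorem natCast_mul_coeff_generator (k : ℕ) (f : R) :
    (k • coeff k (generator δ)) f = -natDer δ k f := by
  cases k with
  | zero => simp [natDer_zero]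
  | succ k =>
    rw [coeff_generator_succ, LinearMap.smul_apply, LinearMap.neg_apply, LinearMap.smul_apply,
      ← Nat.cast_smul_eq_nsmul ℝ, smul_neg, smul_smul, mul_inv_cancel₀ (by positivity), one_smul]
    rfl

theorem commute_coeff_generator (hδ : ∀ j k f, δ j (δ k f) = δ k (δ j f)) (i j : ℕ) :
    Commute (coeff i (generator δ)) (coeff j (generator δ)) := by
  cases i with
  | zero => rw [coeff_generator_zero]; exact Commute.zero_left _
  | succ i =>
    cases j with
    | zero => rw [coeff_generator_zero]; exact Commute.zero_right _
    | succ j =>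
      rw [coeff_generator_succ, coeff_generator_succ]
      refine LinearMap.ext fun f => ?_
      simp only [Module.End.mul_apply, LinearMap.neg_apply, LinearMap.smul_apply, map_neg, map_smul]
      rw [smul_neg, smul_neg, smul_comm]
      simp only [Derivation.coeFn_coe, hδ j.succPNat i.succPNat]

/-- The generator satisfies XΓ' = -∑ X^k δ_k, so X (exp Γ)' = (XΓ') exp Γ says that the flow
annihilates exp(Γ) f. -/
theorem isShift_expShift (hδ : ∀ j k f, δ j (δ k f) = δ k (δ j f)) : IsShift δ (expShift δ) where
  coeff_zero f := by
    rw [expShift, coeff_mk]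
    simp
  flow_eq_zero f := by
    have hc : ∀ n, coeff n (expShift δ f) = expCoeff (generator δ) n f := fun n => by
      rw [expShift, coeff_mk]
      rfl
    ext1 n
    have h := LinearMap.congr_fun (natCast_mul_expCoeff (generator δ) (coeff_generator_zero δ)
      (commute_coeff_generator δ hδ) n) f
    rw [coeff_flow, map_zero, hc, ← nsmul_eq_mul]
    rw [LinearMap.smul_apply, LinearMap.sum_apply] at h
    rw [h, ← sum_add_distrib]
    refine sum_eq_zero fun p _ => ?_
    rw [Module.End.mul_apply, natCast_mul_coeff_generator, hc, neg_add_cancel]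

end Endomorphisms

end MiwaShift

theorem isShift_miwaShift {A : Type*} [NormedCommRing A] [NormedAlgebra ℝ A] {D : TimeDomain} :
    MiwaShift.IsShift (timeDeriv A D) (miwaShift (A := A) (D := D)) :=
  MiwaShift.isShift_expShift (timeDeriv A D) timeDeriv_comm

/-! ### Wave operators of L: existence and ambiguity. -/

section WaveOperators

open PsiDO

variable {A : Type*} [NormedCommRing A] [NormedAlgebra ℝ A] {D : TimeDomain}
  {L Φ : PsiDO (SmoothFn A D)}

theorem timeDeriv_deriv (k : ℕ+) (f : SmoothFn A D) :
    timeDeriv A D k ((Differential.deriv : Derivation ℤ (SmoothFn A D) (SmoothFn A D)) f) =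
      (Differential.deriv : Derivation ℤ (SmoothFn A D) (SmoothFn A D)) (timeDeriv A D k f) :=
  timeDeriv_comm k 1 f

theorem IsLaxOperator.pos_eq (hL : IsLaxOperator L) : L.pos = dPow 1 := by
  ext1
  funext i
  rw [coeff_pos_part, coeff_dPow]
  rcases lt_trichotomy i 1 with h | rfl | h
  · rw [if_neg h.ne]
    split_ifs with h'
    · rw [show i = 0 by omega, hL.2.2]
    · rfl
  · rw [if_pos (by omega), if_pos rfl, hL.2.1]
  · rw [hL.1 i h, ite_self, if_neg h.ne']

theorem IsWaveOperator.isUnipotent (h : IsWaveOperator L Φ) : IsUnipotent Φ :=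
  ⟨h.coeff_pos, h.coeff_zero⟩

theorem IsWaveOperator.mul_eq (h : IsWaveOperator L Φ) : L * Φ = Φ * dPow 1 := by
  obtain ⟨Ψ, -, h2, h3⟩ := h.dressing
  rw [h3, mul_assoc, h2, mul_one]

theorem IsWaveOperator.pow_mul_eq (h : IsWaveOperator L Φ) (r : ℕ) :
    L ^ r * Φ = Φ * dPow (r : ℤ) := by
  induction r with
  | zero =>
    rw [pow_zero, one_mul]
    exact (mul_one Φ).symm
  | succ r ih =>
    rw [pow_succ, mul_assoc, h.mul_eq, ← mul_assoc, ih, mul_assoc, dPow_mul_dPow, Nat.cast_succ]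

/-- The evolution equations of a wave operator, in terms of differential operators. -/
theorem IsWaveOperator.mapCoeff_add (h : IsWaveOperator L Φ) (r : ℕ+) :
    Φ.mapCoeff (timeDeriv A D r) + Φ * dPow ((r : ℕ) : ℤ) = (L ^ (r : ℕ)).pos * Φ := by
  have h1 := h.pow_mul_eq r
  have h2 : Φ.mapCoeff (timeDeriv A D r) = -((L ^ (r : ℕ)).neg * Φ) := h.evolution r
  have h3 := (L ^ (r : ℕ)).pos_add_neg_part
  rw [h2, ← h1]
  nth_rewrite 2 [← h3]
  rw [add_mul]
  abel

/-- The first evolution equation implies that `Φ` dresses `∂` to `L`. -/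
theorem isWaveOperator_of_evolution (hL : IsLaxOperator L) (hΦ : IsUnipotent Φ)
    (h : ∀ r : ℕ+, Φ.mapCoeff (timeDeriv A D r) = -((L ^ (r : ℕ)).neg * Φ)) :
    IsWaveOperator L Φ := by
  refine ⟨hΦ.1, hΦ.2, ?_, h⟩
  obtain ⟨Ψ, -, h1, h2⟩ := hΦ.exists_inv
  refine ⟨Ψ, h1, h2, ?_⟩
  -- Here x = t₁ enters: ∂ ∘ Φ = ∂₁Φ + Φ ∘ ∂ and L = ∂ + L₋ turn the equation for r = 1 into LΦ =
  -- Φ∂.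
  have h3 := dPow_one_mul_eq (d := timeDeriv A D 1) (fun _ => rfl) Φ
  have h4 := h 1
  rw [PNat.one_coe, pow_one] at h4
  have h5 : dPow 1 + L.neg = L := by rw [← hL.pos_eq]; exact L.pos_add_neg_part
  have h6 : L * Φ = Φ * dPow 1 := by
    rw [h4] at h3
    rw [← h5, add_mul, h3]
    abel
  rw [← h6, mul_assoc, h1, mul_one]

theorem exists_isWaveOperator [CompleteSpace A] (hL : IsLaxOperator L) (hKP : SolvesKP L) :
    ∃ Φ, IsWaveOperator L Φ := by
  obtain ⟨Φ, h1, h2⟩ := exists_evolution timeDeriv_deriv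
    SmoothFn.exists_timeDeriv_eq (N := fun r => (L ^ (r : ℕ)).neg)
    (fun r => orderLE_neg_part _) (zero_curvature timeDeriv_deriv hKP)
  exact ⟨Φ, isWaveOperator_of_evolution hL h1 h2⟩

/-- Constant coefficients commute with ∂, so the composition reduces to the Cauchy product of the
symbols. -/
theorem waveSeries_mul {K : PsiDO (SmoothFn A D)} (hΦ : OrderLE 0 Φ) (hK : OrderLE 0 K)
    (hK' : ∀ k, K.mapCoeff (timeDeriv A D k) = 0) :
    waveSeries (Φ * K) = waveSeries Φ * waveSeries K := by
  ext1 n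
  rw [waveSeries, PowerSeries.coeff_mk, coeff_mul_of_deriv_eq_zero
    (fun i => congrArg (fun P : PsiDO (SmoothFn A D) => P.coeff i) (hK' 1)),
    PowerSeries.coeff_mul, Finset.Nat.sum_antidiagonal_eq_sum_range_succ
    (fun i j => PowerSeries.coeff i (waveSeries Φ) * PowerSeries.coeff j (waveSeries K))]
  rw [finsum_eq_sum_of_support_subset (s := (Finset.range (n + 1)).image fun k : ℕ => -(k : ℤ))]
  · rw [Finset.sum_image fun a _ b _ h => by simpa using h]
    refine Finset.sum_congr rfl fun k hk => ?_
    have hk : k ≤ n := by simpa [Nat.lt_succ_iff] using hk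
    rw [waveSeries, waveSeries, PowerSeries.coeff_mk, PowerSeries.coeff_mk]
    congr 2
    push_cast [hk]
    ring
  · intro i hi
    by_contra hc
    apply hi
    rcases lt_or_ge 0 i with h | h
    · simp [hΦ i h]
    · obtain ⟨m, rfl⟩ := Int.exists_eq_neg_ofNat h
      have hm : n < m := by
        by_contra hm
        exact hc (by
          rw [Finset.coe_image]
          exact ⟨m, by simp only [Finset.coe_range, Set.mem_Iio]; omega, rfl⟩)
      simp only [hK (-n - -m) (by omega), mul_zero]

/-- For K = Φ⁻¹Φ', both Φ and ΦK solve the same linear system, so Φ ∂_k K = 0. -/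
theorem IsWaveOperator.exists_eq_mul {Φ' : PsiDO (SmoothFn A D)} (h : IsWaveOperator L Φ)
    (h' : IsWaveOperator L Φ') : ∃ K, IsUnipotent K ∧ Φ' = Φ * K ∧
      ∀ k, K.mapCoeff (timeDeriv A D k) = 0 := by
  obtain ⟨Ψ, hΨ, h1, h2⟩ := h.isUnipotent.exists_inv
  have hK : Φ' = Φ * (Ψ * Φ') := by rw [← mul_assoc, h1, one_mul]
  refine ⟨Ψ * Φ', hΨ.mul h'.isUnipotent, hK, fun k => ?_⟩
  generalize Ψ * Φ' = K at *
  have h3 := h'.evolution k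
  rw [hK, mapCoeff_mul (timeDeriv_deriv k), h.evolution, neg_mul, mul_assoc] at h3
  have h4 : Φ * K.mapCoeff (timeDeriv A D k) = 0 := add_eq_left.1 h3
  rw [← one_mul (K.mapCoeff _), ← h2, mul_assoc, h4, mul_zero]

theorem IsWaveOperator.mul {K : PsiDO (SmoothFn A D)} (hL : IsLaxOperator L)
    (h : IsWaveOperator L Φ) (hK : IsUnipotent K)
    (hK' : ∀ k, K.mapCoeff (timeDeriv A D k) = 0) : IsWaveOperator L (Φ * K) := by
  refine isWaveOperator_of_evolution hL (h.isUnipotent.mul hK) fun r => ?_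
  have h1 : Φ.mapCoeff (timeDeriv A D r) = -((L ^ (r : ℕ)).neg * Φ) := h.evolution r
  rw [mapCoeff_mul (timeDeriv_deriv r), hK', mul_zero, add_zero, h1, neg_mul, mul_assoc]

end WaveOperators

/-! ### Existence and uniqueness of τ-functions. -/

section Tau

open PsiDO MiwaShift

variable {A : Type*} [NormedCommRing A] [NormedAlgebra ℝ A] {D : TimeDomain}
  {L Φ : PsiDO (SmoothFn A D)}

theorem isTauOfWave_iff {τ : (SmoothFn A D)ˣ} :
    IsTauOfWave Φ τ ↔ waveSeries Φ = ratio isShift_miwaShift τ := by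
  rw [ratio_apply, IsTauOfWave]

theorem coeff_zero_waveSeries (h : IsWaveOperator L Φ) :
    PowerSeries.coeff 0 (waveSeries Φ) = 1 := by
  rw [waveSeries, PowerSeries.coeff_mk]
  exact h.coeff_zero

theorem IsWaveOperator.satisfiesFay (h : IsWaveOperator L Φ) :
    SatisfiesFay miwaShift (waveSeries Φ) := by
  rw [waveSeries]
  exact PsiDO.satisfiesFay isShift_miwaShift timeDeriv_deriv
    (fun r => isDifferential_pos (L ^ (r : ℕ))) h.isUnipotent h.mapCoeff_add

theorem SmoothFn.hasLogIntegrals [CompleteSpace A] : HasLogIntegrals (timeDeriv A D) := by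
  intro b hb
  obtain ⟨θ, hθ⟩ := SmoothFn.exists_timeDeriv_eq b hb
  refine ⟨SmoothFn.expUnit θ, fun k => ?_⟩
  rw [← hθ k]
  exact SmoothFn.timeDeriv_exp θ k

/-- Every wave operator has a `τ`-function. -/
theorem IsWaveOperator.exists_isTauOfWave [CompleteSpace A] (h : IsWaveOperator L Φ) :
    ∃ τ, IsTauOfWave Φ τ := by
  have hW := coeff_zero_waveSeries h
  obtain ⟨τ, hτ⟩ := SatisfiesFay.exists_eq_ratio (δ := timeDeriv A D) (W := waveSeries Φ)
    isShift_miwaShift timeDeriv_comm SmoothFn.hasLogIntegrals hW h.satisfiesFay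
  exact ⟨τ, isTauOfWave_iff.2 hτ⟩

theorem SmoothFn.isUnit_apply (σ : (SmoothFn A D)ˣ) (t : D.carrier) : IsUnit (σ.1.1 t) :=
  IsUnit.of_mul_eq_one ((σ⁻¹).1.1 t)
    (congrArg (fun f : SmoothFn A D => f.1 t) σ.mul_inv)

/-- Units with the logarithmic derivatives of `exp (∑ C_k t_k)`. -/
theorem timeDeriv_unit_iff [CompleteSpace A] (σ : (SmoothFn A D)ˣ) (C : ℕ+ → A) :
    (∀ k, timeDeriv A D k (σ : SmoothFn A D) = SmoothFn.const D (C k) * σ) ↔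
      ∃ C₀ : Aˣ, ∀ t : D.carrier,
        σ.1.1 t = C₀ * NormedSpace.exp (t.1.sum fun k s => s • C k) := by
  let E := SmoothFn.expUnit (SmoothFn.linear D C)
  have hE : ∀ k, timeDeriv A D k (E : SmoothFn A D) = SmoothFn.const D (C k) * E := fun k => by
    rw [SmoothFn.val_expUnit, SmoothFn.timeDeriv_exp, SmoothFn.timeDeriv_linear]
  constructor
  · intro h
    have hd : ∀ k, timeDeriv A D k ((σ * E⁻¹ : (SmoothFn A D)ˣ) : SmoothFn A D) = 0 := fun k => by
      have h1 : (σ : SmoothFn A D) = ((σ * E⁻¹ : (SmoothFn A D)ˣ) : SmoothFn A D) * E := by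
        rw [← Units.val_mul, inv_mul_cancel_right]
      have h2 := h k
      rw [h1, Derivation.leibniz, hE] at h2
      simp only [smul_eq_mul] at h2
      refine E.isUnit.mul_left_cancel ?_
      linear_combination h2
    obtain ⟨a, ha⟩ := SmoothFn.exists_eq_const _ hd
    obtain ⟨t₀, ht₀, -⟩ := D.exists_center
    have hu := SmoothFn.isUnit_apply (σ * E⁻¹) ⟨t₀, ht₀⟩
    rw [ha] at hu
    refine ⟨hu.unit, fun t => ?_⟩
    have h1 : (σ : SmoothFn A D) = ((σ * E⁻¹ : (SmoothFn A D)ˣ) : SmoothFn A D) * E := by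
      rw [← Units.val_mul, inv_mul_cancel_right]
    have h2 := congrArg (fun f : SmoothFn A D => f.1 t) h1
    exact h2.trans (congrArg (· * E.1.1 t) (ha t))
  · rintro ⟨C₀, h⟩ k
    have h1 : (σ : SmoothFn A D) = SmoothFn.const D (C₀ : A) * E := Subtype.ext (funext h)
    rw [h1, Derivation.leibniz, hE, SmoothFn.timeDeriv_const]
    simp only [smul_eq_mul]
    ring

theorem timeDeriv_unit_eq_zero_iff (σ : (SmoothFn A D)ˣ) :
    (∀ k, timeDeriv A D k (σ : SmoothFn A D) = 0) ↔ ∃ C₀ : Aˣ, ∀ t : D.carrier, σ.1.1 t = C₀ := by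
  constructor
  · intro h
    obtain ⟨a, ha⟩ := SmoothFn.exists_eq_const _ h
    obtain ⟨t₀, ht₀, -⟩ := D.exists_center
    have hu := SmoothFn.isUnit_apply σ ⟨t₀, ht₀⟩
    rw [ha] at hu
    exact ⟨hu.unit, ha⟩
  · rintro ⟨C₀, h⟩ k
    have h1 : (σ : SmoothFn A D) = SmoothFn.const D (C₀ : A) := Subtype.ext (funext h)
    rw [h1, SmoothFn.timeDeriv_const]

theorem SmoothFn.unit_mul_inv_apply (τ' τ : (SmoothFn A D)ˣ) (t : D.carrier) (a : A) :
    (τ' * τ⁻¹).1.1 t = a ↔ τ'.1.1 t = a * τ.1.1 t := by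
  have h : τ'.1.1 t = (τ' * τ⁻¹).1.1 t * τ.1.1 t := by
    conv_lhs => rw [← inv_mul_cancel_right τ' τ]
    rfl
  rw [h, (SmoothFn.isUnit_apply τ t).mul_left_inj]

theorem isTauOfWave_iff_of_isTauOfWave {τ τ' : (SmoothFn A D)ˣ} (h : IsTauOfWave Φ τ) :
    IsTauOfWave Φ τ' ↔ ∃ C₀ : Aˣ, ∀ t : D.carrier, τ'.1.1 t = C₀ * τ.1.1 t := by
  simp only [← SmoothFn.unit_mul_inv_apply]
  rw [← timeDeriv_unit_eq_zero_iff, isTauOfWave_iff, isTauOfWave_iff.1 h,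
    ratio_eq_ratio_iff]

/-- Changing the wave operator multiplies Ŵ by an arbitrary constant series with constant term 1. So
τ' is admissible exactly when the ratio of τ'τ⁻¹ is constant, which means constant logarithmic
derivatives. -/
theorem isTauFunction_iff_of_isTauFunction [CompleteSpace A] (hL : IsLaxOperator L)
    {τ τ' : (SmoothFn A D)ˣ} (h : IsTauFunction L τ) :
    IsTauFunction L τ' ↔ ∃ (C₀ : Aˣ) (C : ℕ+ → A), ∀ t : D.carrier,
      τ'.1.1 t = C₀ * NormedSpace.exp (t.1.sum fun k s => s • C k) * τ.1.1 t := by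
  obtain ⟨Φ, hΦ, hτ⟩ := h
  have hG : IsShift (timeDeriv A D) miwaShift := isShift_miwaShift
  rw [isTauOfWave_iff] at hτ
  simp only [← SmoothFn.unit_mul_inv_apply]
  rw [exists_comm]
  simp only [← timeDeriv_unit_iff]
  have h1 := ratio_eq_ratio_mul hG τ' τ
  constructor
  · rintro ⟨Φ', hΦ', hτ'⟩
    obtain ⟨K, hK, rfl, hK'⟩ := hΦ.exists_eq_mul hΦ'
    rw [isTauOfWave_iff, waveSeries_mul hΦ.isUnipotent.1 hK.1 hK', hτ] at hτ'
    have h2 : waveSeries K = ratio hG (τ' * τ⁻¹) :=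
      (isUnit_ratio hG τ).mul_left_cancel (hτ'.trans h1)
    obtain ⟨c, hc, hc'⟩ := der_eq_of_ratio hG timeDeriv_comm (σ := τ' * τ⁻¹) fun k => by
      ext1 n
      rw [← h2, coeff_mapDer, map_zero, waveSeries, PowerSeries.coeff_mk]
      exact congrArg (fun P : PsiDO (SmoothFn A D) => P.coeff (-(n : ℤ))) (hK' k)
    choose a ha using fun k => SmoothFn.exists_eq_const (c k) fun j => hc j k
    refine ⟨a, fun k => ?_⟩
    rw [hc', show c k = SmoothFn.const D (a k) from Subtype.ext (funext (ha k))]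
  · rintro ⟨C, hC⟩
    have hconst := mapDer_ratio_eq_zero hG timeDeriv_comm
      (fun j k => SmoothFn.timeDeriv_const (C k) j) hC
    -- The constant ratio serves as the symbol of the right factor that changes Φ into a wave
    -- operator for τ'.
    let K := ofSeq fun n => PowerSeries.coeff n (ratio hG (τ' * τ⁻¹))
    have hK : IsUnipotent K := isUnipotent_ofSeq (coeff_zero_ratio hG _)
    have hKW : waveSeries K = ratio hG (τ' * τ⁻¹) := by
      ext1 n
      rw [waveSeries, PowerSeries.coeff_mk, coeff_ofSeq_neg]
    have hK' : ∀ k, K.mapCoeff (timeDeriv A D k) = 0 := fun k =>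
      ofSeq_ext (hK.1.mapCoeff _) (fun _ _ => rfl) fun n => by
        rw [coeff_mapCoeff, coeff_ofSeq_neg, ← coeff_mapDer, hconst, map_zero]
        rfl
    refine ⟨Φ * K, hΦ.mul hL hK hK', ?_⟩
    rw [isTauOfWave_iff, waveSeries_mul hΦ.isUnipotent.1 hK.1 hK', hτ, hKW, h1]

end Tau

end

theorem mainTheorem1 {A : Type*} [NormedCommRing A] [NormedAlgebra ℝ A] [FiniteDimensional ℝ A]
    (tr : Module.Dual ℝ A) (htr : IsFrobeniusForm tr) (D : TimeDomain)
    (L : PsiDO (SmoothFn A D)) (hL : IsLaxOperator L) (hKP : SolvesKP L) :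
    (∃ Φ, IsWaveOperator L Φ) ∧
    (∀ Φ, IsWaveOperator L Φ →
      ∃ τ : (SmoothFn A D)ˣ, IsTauOfWave Φ τ ∧
        ∀ τ' : (SmoothFn A D)ˣ, IsTauOfWave Φ τ' ↔
          ∃ C₀ : Aˣ, ∀ t : D.carrier, τ'.1.1 t = C₀ * τ.1.1 t) ∧
    (∀ τ : (SmoothFn A D)ˣ, IsTauFunction L τ →
      ∀ τ' : (SmoothFn A D)ˣ, IsTauFunction L τ' ↔
        ∃ (C₀ : Aˣ) (C : ℕ+ → A), ∀ t : D.carrier,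
          τ'.1.1 t = C₀ * NormedSpace.exp (t.1.sum fun k s => s • C k) * τ.1.1 t) := by
  have : CompleteSpace A := FiniteDimensional.complete ℝ A
  refine ⟨exists_isWaveOperator hL hKP, fun Φ hΦ => ?_, fun τ hτ τ' =>
    isTauFunction_iff_of_isTauFunction hL hτ⟩
  obtain ⟨τ, hτ⟩ := hΦ.exists_isTauOfWave
  exact ⟨τ, hτ, fun τ' => isTauOfWave_iff_of_isTauOfWave hτ⟩
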